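/- Let $n\ge 1$, $\sigma\in[0,2]$, $s\ge 0$ and $\delta\in(0,1]$. Consider the Cauchy problem $$ \begin{cases} u_{tt}+\Delta^2u+\Delta\theta+(-\Delta)^{\sigma}u_t=0,& t>0,\ x\in\mathbb R^n,\\ \theta_t-\Delta\theta-\Delta u_t=0,& t>0,\ x\in\mathbb R^n,\\ (u,u_t,\theta)(0,x)=(u_0,u_1,\theta_0)(x),& x\in\mathbb R^n, \end{cases} $$ whose solutions are taken in the class $|D|^2u,\ u_t,\ \theta\in\mathcal C([0,\infty),L^2(\mathbb R^n))$, the equations being understood in the sense of tempered distributions. Here $|D|^s$ and $\langle D\rangle^s$ are the Fourier multipliers with symbols $|\xi|^s$ and $(1+|\xi|^2)^{s/2}$ (so $|D|^2=-\Delta$), $\|f\|_{\dot H^s}=\||D|^sf\|_{L^2}$, $\|f\|_{H^s}=\|\langle D\rangle^sf\|_{L^2}$, and $L^{1,\delta}(\mathbb R^n)$ is the space of $f\in L^1(\mathbb R^n)$ with $\|f\|_{L^{1,\delta}}=\int_{\mathbb R^n}(1+|x|)^\delta|f(x)|\,dx<\infty$. Put $$ \gamma(\sigma,n,1,s)=\frac{n+2s}{4(2-\sigma)}\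 \text{ if }\sigma\in[0,1),\qquad \gamma(\sigma,n,1,s)=\frac{n+2s}{4}\ \text{ if }\sigma\in[1,2], $$ and $U_0=(u_1+|D|^2u_0,\ u_1-|D|^2u_0,\ \theta_0)^{\mathrm T}$. There is a constant $C>0$, depending only on $n,\sigma,s,\delta$, such that for all data with $(|D|^2u_0,u_1,\theta_0)\in\mathcal B_{\delta,s}:=\big(H^s(\mathbb R^n)\cap L^{1,\delta}(\mathbb R^n)\big)^3$ (normed by the sum of the $H^s$ and $L^{1,\delta}$ norms of the components) the solution satisfies, for all $t\ge0$, $$ \||D|^2u(t,\cdot)\|_{\dot H^s}+\|u_t(t,\cdot)\|_{\dot H^s}+\|\theta(t,\cdot)\|_{\dot H^s} \le C(1+t)^{-\gamma(\sigma,n,1,s+\delta)}\big\|(|D|^2u_0,u_1,\theta_0)\big\|_{\mathcal B_{\delta,s}} +C(1+t)^{-\gamma(\sigma,n,1,s)}\Big|\int_{\mathbb R^n}U_0(x)\,dx\Big| . $$ In particular, if $\int_{\mathbb R^n}U_0(x)\,dx=0$, then for all $t\ge 0$ the left-hand side is at most $$ C(1+t)^{-\gamma(\sigma,n,1,s)}\,(1+t)^{-\frac{\delta}{2\max\{2-\sigma,1\}}}\,\big\|(|D|^2u_0,u_1,\theta_0)\big\|_{\mathcal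 B_{\delta,s}}, $$ that is, there is the extra decay $(1+t)^{-\delta/(2(2-\sigma))}$ for $\sigma\in[0,1)$ and $(1+t)^{-\delta/2}$ for $\sigma\in[1,2]$. -/

import Mathlib

open MeasureTheory
open scoped ENNReal NNReal FourierTransform SchwartzMap Laplacian

noncomputable section

namespace ThermoPlate

/-- The Euclidean space `ℝⁿ`. -/
abbrev Rn (n : ℕ) := EuclideanSpace ℝ (Fin n)

/-- The complex Hilbert space `L²(ℝⁿ)`. -/
abbrev L2 (n : ℕ) := Lp ℂ 2 (volume : Measure (Rn n))

/-- The tempered distribution given by an `L²` function. -/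
def toDist {n : ℕ} (f : L2 n) : 𝓢'(Rn n, ℂ) := Lp.toTemperedDistribution f

/-- The (unitary) Fourier transform of an `L²` function; the Fourier variable is normalised so that
`|D|` has the symbol `2π|ξ|`. -/
def hat {n : ℕ} (f : L2 n) : L2 n := 𝓕 f

/-- The norm of `f` in the homogeneous space `Ḣˢ`, that is the `L²` norm of `|D|ˢ f`; it is `∞` when
`f` does not belong to `Ḣˢ`. -/
def homSobolevNorm {n : ℕ} (s : ℝ) (f : L2 n) : ℝ≥0∞ :=
  eLpNorm (fun ξ : Rn n => (((2 * Real.pi * ‖ξ‖) ^ s : ℝ) : ℂ) * hat f ξ) 2 volume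

/-- The norm of `f` in `Hˢ`, that is the `L²` norm of `⟨D⟩ˢ f = (1 + |D|²)^(s/2) f`; it is `∞` when
`f` does not belong to `Hˢ`. -/
def sobolevNorm {n : ℕ} (s : ℝ) (f : L2 n) : ℝ≥0∞ :=
  eLpNorm (fun ξ : Rn n => (((1 + (2 * Real.pi * ‖ξ‖) ^ 2) ^ (s / 2) : ℝ) : ℂ) * hat f ξ) 2 volume

/-- The norm `∫ (1 + |x|)^δ |f(x)| dx` of the weighted space `L^{1,δ}`. -/
def weightedL1Norm {n : ℕ} (δ : ℝ) (f : L2 n) : ℝ≥0∞ :=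
  ∫⁻ x : Rn n, ENNReal.ofReal ((1 + ‖x‖) ^ δ) * ‖f x‖ₑ

/-- Membership in `Hˢ ∩ L^{1,δ}` (for `s ≥ 0`, where this is a subset of `L²`). -/
def MemSobolevWeightedL1 {n : ℕ} (s δ : ℝ) (f : L2 n) : Prop :=
  sobolevNorm s f < ∞ ∧ MemLp f 1 volume ∧ weightedL1Norm δ f < ∞

/-- The norm of a triple in `(Hˢ ∩ L^{1,δ})³`. -/
def dataNorm {n : ℕ} (s δ : ℝ) (f g h : L2 n) : ℝ≥0∞ :=
  (sobolevNorm s f + weightedL1Norm δ f) + (sobolevNorm s g + weightedL1Norm δ g) +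
    (sobolevNorm s h + weightedL1Norm δ h)

/-- The distribution `(-Δ)^σ f` for `f ∈ L²`, tested against a Schwartz function `φ`: it is the
inverse Fourier transform of the tempered distribution given by the locally integrable,
polynomially bounded (in the weighted `L²` sense) function `(2π|ξ|)^(2σ) f̂(ξ)`. -/
def fracLaplacian {n : ℕ} (σ : ℝ) (f : L2 n) (φ : 𝓢(Rn n, ℂ)) : ℂ :=
  ∫ ξ : Rn n, (((2 * Real.pi * ‖ξ‖) ^ (2 * σ) : ℝ) : ℂ) * hat f ξ * (𝓕⁻ φ : 𝓢(Rn n, ℂ)) ξ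

/-- `IsSolution σ u₀ u₁ θ₀ u w v θ` says that `(u, θ)` is a solution of the Cauchy problem
`u_tt + Δ²u + Δθ + (-Δ)^σ u_t = 0`, `θ_t - Δθ - Δu_t = 0` on `(0,∞) × ℝⁿ`,
`(u, u_t, θ)(0) = (u₀, u₁, θ₀)`, in the class
`u ∈ C([0,∞), Ḣ²)`, `u_t ∈ C([0,∞), L²)`, `θ ∈ C([0,∞), L²)`,
where `w = |D|²u = -Δu` and `v = u_t`. Each `u t` is a tempered distribution with `|D|²u(t) ∈ L²`,
and the equations hold in the sense of tempered distributions in `x` for each `t > 0`. -/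
structure IsSolution {n : ℕ} (σ : ℝ) (u₀ : 𝓢'(Rn n, ℂ)) (u₁ θ₀ : L2 n)
    (u : ℝ → 𝓢'(Rn n, ℂ)) (w v θ : ℝ → L2 n) : Prop where
  neg_laplacian_eq : ∀ t : ℝ, 0 ≤ t → -(Δ (u t)) = toDist (w t)
  continuousOn_u : ∀ φ : 𝓢(Rn n, ℂ), ContinuousOn (fun t => u t φ) (Set.Ici 0)
  continuousOn_w : ContinuousOn w (Set.Ici 0)
  continuousOn_v : ContinuousOn v (Set.Ici 0)
  continuousOn_θ : ContinuousOn θ (Set.Ici 0)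
  hasDerivAt_u : ∀ (φ : 𝓢(Rn n, ℂ)) (t : ℝ), 0 < t →
    HasDerivAt (fun τ => u τ φ) (toDist (v t) φ) t
  hasDerivAt_v : ∀ (φ : 𝓢(Rn n, ℂ)) (t : ℝ), 0 < t →
    HasDerivAt (fun τ => toDist (v τ) φ)
      (-(Δ (Δ (u t))) φ - (Δ (toDist (θ t))) φ - fracLaplacian σ (v t) φ) t
  hasDerivAt_θ : ∀ (φ : 𝓢(Rn n, ℂ)) (t : ℝ), 0 < t →
    HasDerivAt (fun τ => toDist (θ τ) φ)
      ((Δ (toDist (θ t))) φ + (Δ (toDist (v t))) φ) t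
  u_zero : u 0 = u₀
  v_zero : v 0 = u₁
  θ_zero : θ 0 = θ₀

/-- `U₀ = (u₁ + |D|²u₀, u₁ - |D|²u₀, θ₀)` as a `ℂ³`-valued function, with `w₀ = |D|²u₀`. -/
def initialU {n : ℕ} (w₀ u₁ θ₀ : L2 n) (x : Rn n) : EuclideanSpace ℂ (Fin 3) :=
  !₂[u₁ x + w₀ x, u₁ x - w₀ x, θ₀ x]

/-- The decay exponent `γ(σ, n, m, s)`. -/
def decayExponent (σ : ℝ) (n : ℕ) (m s : ℝ) : ℝ :=
  if σ < 1 then ((2 - m) * n + 2 * m * s) / (4 * m * (2 - σ))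
  else ((2 - m) * n + 2 * m * s) / (4 * m)

end ThermoPlate

end

namespace ThermoPlate

open Set Filter
open scoped Topology

variable {n : ℕ}

/-! On the Fourier side, with `p = |D|²` and `d = |D|^(2σ)` read as symbols, the system becomes the
ODE `w' = p v`, `v' = -p w + p θ - d v`, `θ' = -p θ - p v` at each frequency. The energy `|w|² +
|v|² + |θ|²` dissipates only `2 d |v|² + 2 p |θ|²`. Small multiples of `Re (v w̄)` and `Re (θ v̄)`
recover the missing damping of `w`, and that of `v` when `d < p` (`dissipation_le`). The energy then
decays at a rate comparable to `p² / max d p`.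

Solutions satisfy the equations only weakly, so this is not directly a pointwise ODE. Multiplying by
the weight `cutoff` makes all symbols bounded, and the weak equations become strong `L²`-valued ones
(`hasDerivAt_of_toDist`). A Gronwall argument over arbitrary measurable frequency sets is then
localised to almost every `ξ` (`lyapInt_le`, `ae_energy_hat_le`), and the weight cancels.

For `|D| ≥ 1` the rate is at least `1`, which gives exponential decay without loss of derivatives.
For `|D| ≤ 1` the rate is at least `|D|^(2 max (2-σ) 1)`, and `f̂(ξ) = ∫ f + O(|ξ|^δ)` for `f ∈
L^{1,δ}`. Scaling of `|D|^a exp(-c t |D|^(2m))` in `L²` turns the power `|ξ|^δ` into the additional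
decay (`eLpNorm_profile`, `exists_eLpNorm_evolved_le`). -/

/-! ### Weak and strong derivatives in `L²` -/

/-- Testing an `L²` function against a Schwartz function, as a continuous linear functional. -/
noncomputable def testCLM (φ : 𝓢(Rn n, ℂ)) : L2 n →L[ℂ] ℂ :=
  ((ContinuousLinearMap.mul ℂ ℂ).lpPairing (volume : Measure (Rn n)) 2 2) (φ.toLp 2)

theorem toDist_apply (f : L2 n) (φ : 𝓢(Rn n, ℂ)) : toDist f φ = ∫ x, φ x * f x := by
  simp [toDist]

theorem testCLM_apply (φ : 𝓢(Rn n, ℂ)) (f : L2 n) : testCLM φ f = toDist f φ := by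
  rw [toDist_apply, testCLM, ContinuousLinearMap.lpPairing_eq_integral]
  refine integral_congr_ae ?_
  filter_upwards [φ.coeFn_toLp 2 volume] with x hx
  simp [hx]

theorem eq_zero_of_toDist_eq_zero {f : L2 n} (h : ∀ φ, toDist f φ = 0) : f = 0 := by
  have hker := Lp.ker_toTemperedDistributionCLM_eq_bot (E := Rn n) (F := ℂ) (μ := volume) (p := 2)
  rw [LinearMap.ker_eq_bot', ContinuousLinearMap.coe_coe] at hker
  apply hker
  ext φ
  exact h φ

/-- Multiplication by an essentially bounded function on `L²`. -/
noncomputable def mulL {m : Rn n → ℝ} (hm : MemLp m ∞ volume) : L2 n →L[ℝ] L2 n :=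
  (ContinuousLinearMap.lsmul ℝ ℝ : ℝ →L[ℝ] ℂ →L[ℝ] ℂ).holderL volume ∞ 2 2 hm.toLp

theorem coeFn_mulL {m : Rn n → ℝ} (hm : MemLp m ∞ volume) (f : L2 n) :
    mulL hm f =ᵐ[volume] fun x => (m x : ℂ) * f x := by
  have h := (ContinuousLinearMap.lsmul ℝ ℝ : ℝ →L[ℝ] ℂ →L[ℝ] ℂ).coeFn_holder (r := 2) hm.toLp f
  filter_upwards [h, hm.coeFn_toLp] with x hx hx'
  rw [mulL, ContinuousLinearMap.holderL_apply_apply, hx, hx']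
  simp

/-- A weak derivative that is continuous with values in `L²` is a strong derivative. -/
theorem hasDerivAt_of_toDist {Y Z : ℝ → L2 n} (hZ : ContinuousOn Z (Ioi 0))
    (h : ∀ (φ : 𝓢(Rn n, ℂ)) (t : ℝ), 0 < t →
      HasDerivAt (fun τ => toDist (Y τ) φ) (toDist (Z t) φ) t) {t : ℝ} (ht : 0 < t) :
    HasDerivAt Y (Z t) t := by
  have hF : ∀ τ, 0 < τ → HasDerivAt (fun τ => ∫ r in t..τ, Z r) (Z τ) τ := by
    intro τ hτ
    refine intervalIntegral.integral_hasDerivAt_right ?_ ?_ ?_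
    · refine (hZ.mono ?_).intervalIntegrable
      intro x hx
      exact lt_of_lt_of_le (lt_min ht hτ) hx.1
    · exact hZ.stronglyMeasurableAtFilter isOpen_Ioi _ hτ
    · exact hZ.continuousAt (Ioi_mem_nhds hτ)
  -- Tested against any `φ`, the difference `Y τ - ∫ Z` has zero derivative, hence is constant;
  -- Schwartz functions separate points of `L²`.
  have key : ∀ τ, 0 < τ → Y τ = (∫ r in t..τ, Z r) + Y t := by
    intro τ hτ
    rw [← sub_eq_zero]
    refine eq_zero_of_toDist_eq_zero fun φ => ?_
    have hd : ∀ x ∈ Ioi (0 : ℝ), HasDerivWithinAt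
        (fun τ => testCLM φ (Y τ) - testCLM φ (∫ r in t..τ, Z r)) 0 (Ioi 0) x := by
      intro x hx
      have h1 : HasDerivAt (fun τ => testCLM φ (Y τ)) (testCLM φ (Z x)) x := by
        simpa only [testCLM_apply] using h φ x hx
      have h2 := (((testCLM φ).restrictScalars ℝ).hasFDerivAt.comp_hasDerivAt x (hF x hx))
      have h3 := (h1.sub h2).hasDerivWithinAt (s := Ioi 0)
      rw [show testCLM φ (Z x) - ((testCLM φ).restrictScalars ℝ) (Z x) = 0 from sub_self _] at h3
      exact h3
    have hc := (convex_Ioi (0 : ℝ)).is_const_of_fderivWithin_eq_zero (𝕜 := ℝ)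
      (f := fun τ => testCLM φ (Y τ) - testCLM φ (∫ r in t..τ, Z r))
      (fun x hx => (hd x hx).differentiableWithinAt) (fun x hx => by
        have := (hd x hx).hasFDerivWithinAt.fderivWithin (isOpen_Ioi.uniqueDiffWithinAt hx)
        rw [this]; ext; simp) (mem_Ioi.2 hτ) (mem_Ioi.2 ht)
    simp only [intervalIntegral.integral_same, map_zero, sub_zero] at hc
    rw [← testCLM_apply, map_sub, map_add, ← hc]
    ring
  refine ((hF t ht).add_const (Y t)).congr_of_eventuallyEq ?_
  filter_upwards [Ioi_mem_nhds ht] with τ hτ using key τ hτ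

/-! ### Frequency cut-off and the symbols of the equation -/

/-- Frequency cut-off making the symbols of the equation bounded. -/
noncomputable def cutoff (ξ : Rn n) : ℝ := (1 + ‖ξ‖ ^ 2) ^ (-2 : ℝ)

theorem cutoff_pos (ξ : Rn n) : 0 < cutoff ξ := by unfold cutoff; positivity

theorem cutoff_hasTemperateGrowth :
    (fun ξ : Rn n => (cutoff ξ : ℂ)).HasTemperateGrowth :=
  Function.HasTemperateGrowth.comp Function.Complex.hasTemperateGrowth_ofReal
    (Function.hasTemperateGrowth_one_add_norm_sq_rpow _ (-2))

theorem measurable_cutoff : Measurable (cutoff : Rn n → ℝ) := by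
  unfold cutoff; fun_prop

/-- The weight decays like `‖ξ‖⁻⁴`; the range `β ≤ 4` covers `|D|²` and, because `σ ≤ 2`, also
`|D|^(2σ)`. -/
theorem rpow_mul_cutoff_le {β : ℝ} (hβ : β ∈ Icc (0 : ℝ) 4) (ξ : Rn n) :
    (2 * Real.pi * ‖ξ‖) ^ β * cutoff ξ ≤ (2 * Real.pi) ^ 4 := by
  have h1 : 1 ≤ 2 * Real.pi := by linarith [Real.pi_gt_three]
  have hx : ‖ξ‖ ^ β ≤ (1 + ‖ξ‖ ^ 2) ^ (2 : ℝ) := by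
    have h2 : ((1 + ‖ξ‖ ^ 2) ^ (1 / 2 : ℝ)) ^ (4 : ℝ) = (1 + ‖ξ‖ ^ 2) ^ (2 : ℝ) := by
      rw [← Real.rpow_mul (by positivity)]; norm_num
    have h3 : 1 ≤ (1 + ‖ξ‖ ^ 2) ^ (1 / 2 : ℝ) :=
      Real.one_le_rpow (by nlinarith [norm_nonneg ξ]) (by norm_num)
    rw [← h2]
    calc ‖ξ‖ ^ β ≤ ((1 + ‖ξ‖ ^ 2) ^ (1 / 2 : ℝ)) ^ β := by
          refine Real.rpow_le_rpow (norm_nonneg _) ?_ hβ.1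
          rw [← Real.sqrt_eq_rpow]
          exact Real.le_sqrt_of_sq_le (by linarith)
      _ ≤ _ := Real.rpow_le_rpow_of_exponent_le h3 hβ.2
  have h4 : (2 * Real.pi) ^ β ≤ (2 * Real.pi) ^ 4 := by
    calc (2 * Real.pi) ^ β ≤ (2 * Real.pi) ^ (4 : ℝ) := Real.rpow_le_rpow_of_exponent_le h1 hβ.2
      _ = _ := by norm_cast
  have h5 : (1 + ‖ξ‖ ^ 2) ^ (2 : ℝ) * cutoff ξ = 1 := by
    rw [cutoff, ← Real.rpow_add (by positivity)]; norm_num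
  rw [Real.mul_rpow (by positivity) (norm_nonneg _)]
  calc _ ≤ (2 * Real.pi) ^ 4 * (1 + ‖ξ‖ ^ 2) ^ (2 : ℝ) * cutoff ξ := by
        have := (cutoff_pos ξ).le
        gcongr
    _ = _ := by rw [mul_assoc, h5, mul_one]

theorem memLp_top_rpow_mul_cutoff {β : ℝ} (hβ : β ∈ Icc (0 : ℝ) 4) :
    MemLp (fun ξ : Rn n => (2 * Real.pi * ‖ξ‖) ^ β * cutoff ξ) ∞ volume := by
  refine memLp_top_of_bound (C := (2 * Real.pi) ^ 4) ?_ (Eventually.of_forall fun ξ => ?_)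
  · have := measurable_cutoff (n := n)
    exact Measurable.aestronglyMeasurable (by fun_prop)
  · rw [Real.norm_of_nonneg (mul_nonneg (by positivity) (cutoff_pos ξ).le)]
    exact rpow_mul_cutoff_le hβ ξ

/-- The operator with symbol `cutoff · |D|^β` on the Fourier side. -/
noncomputable def cutMul {β : ℝ} (hβ : β ∈ Icc (0 : ℝ) 4) (f : L2 n) : L2 n :=
  mulL (memLp_top_rpow_mul_cutoff hβ) (hat f)

theorem coeFn_cutMul {β : ℝ} (hβ : β ∈ Icc (0 : ℝ) 4) (f : L2 n) :
    cutMul hβ f =ᵐ[volume]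
      fun ξ => (((2 * Real.pi * ‖ξ‖) ^ β * cutoff ξ : ℝ) : ℂ) * hat f ξ :=
  coeFn_mulL _ _

theorem continuous_hat : Continuous (hat : L2 n → L2 n) :=
  (Lp.fourierTransformₗᵢ (Rn n) ℂ).continuous

theorem continuous_cutMul {β : ℝ} (hβ : β ∈ Icc (0 : ℝ) 4) :
    Continuous (cutMul hβ : L2 n → L2 n) :=
  (mulL _).continuous.comp continuous_hat

/-- The test function whose inverse Fourier transform is `cutoff · ψ`. -/
noncomputable def cutTest (ψ : 𝓢(Rn n, ℂ)) : 𝓢(Rn n, ℂ) :=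
  𝓕 (SchwartzMap.smulLeftCLM ℂ (fun ξ : Rn n => (cutoff ξ : ℂ)) ψ)

theorem fourierInv_cutTest (ψ : 𝓢(Rn n, ℂ)) (ξ : Rn n) :
    (𝓕⁻ (cutTest ψ) : 𝓢(Rn n, ℂ)) ξ = cutoff ξ * ψ ξ := by
  rw [cutTest, FourierTransform.fourierInv_fourier_eq,
    SchwartzMap.smulLeftCLM_apply_apply cutoff_hasTemperateGrowth, smul_eq_mul]

/-- Parseval's formula: it turns pairings in `x` into pairings in `ξ`, where the operators act by
multiplication. -/
theorem toDist_eq_hat (f : L2 n) (φ : 𝓢(Rn n, ℂ)) :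
    toDist f φ = ∫ ξ, (𝓕⁻ φ : 𝓢(Rn n, ℂ)) ξ * hat f ξ := by
  have h := Lp.fourier_toTemperedDistribution_eq f
  calc toDist f φ = toDist f (𝓕 (𝓕⁻ φ)) := by rw [FourierTransform.fourier_fourierInv_eq]
    _ = (𝓕 (toDist f)) (𝓕⁻ φ) := by rw [TemperedDistribution.fourier_apply]
    _ = toDist (hat f) (𝓕⁻ φ) := by rw [toDist, h]; rfl
    _ = _ := toDist_apply _ _

theorem zero_mem_Icc_four : (0 : ℝ) ∈ Icc (0 : ℝ) 4 := by norm_num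

theorem two_mem_Icc_four : (2 : ℝ) ∈ Icc (0 : ℝ) 4 := by norm_num

theorem toDist_cutTest (f : L2 n) (ψ : 𝓢(Rn n, ℂ)) :
    toDist f (cutTest ψ) = toDist (cutMul zero_mem_Icc_four f) ψ := by
  rw [toDist_eq_hat, toDist_apply]
  refine integral_congr_ae ?_
  filter_upwards [coeFn_cutMul zero_mem_Icc_four f] with ξ hξ
  rw [hξ, fourierInv_cutTest]
  simp; ring

theorem fourierInv_laplacian (φ : 𝓢(Rn n, ℂ)) (ξ : Rn n) :
    (𝓕⁻ (Δ φ) : 𝓢(Rn n, ℂ)) ξ = -(((2 * Real.pi * ‖ξ‖) ^ (2 : ℝ) : ℝ) : ℂ) *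
      (𝓕⁻ φ : 𝓢(Rn n, ℂ)) ξ := by
  have h : ∀ (f : 𝓢(Rn n, ℂ)) (x : Rn n), (𝓕⁻ f : 𝓢(Rn n, ℂ)) x = (𝓕 f : 𝓢(Rn n, ℂ)) (-x) := by
    intro f x
    rw [SchwartzMap.fourierInv_coe, SchwartzMap.fourier_coe, Real.fourierInv_eq_fourier_neg]
  have hg : (fun x : Rn n => ‖x‖ ^ 2).HasTemperateGrowth := Function.hasTemperateGrowth_norm_sq _
  rw [h, h, SchwartzMap.laplacian_eq_fourierMultiplierCLM, SchwartzMap.fourierMultiplierCLM_apply,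
    FourierTransform.fourier_smul, FourierTransform.fourier_fourierInv_eq]
  rw [smul_apply, SchwartzMap.smulLeftCLM_apply_apply hg]
  rw [Real.rpow_two]
  simp
  ring

theorem toDist_laplacian_cutTest (f : L2 n) (ψ : 𝓢(Rn n, ℂ)) :
    toDist f (Δ (cutTest ψ)) = -toDist (cutMul two_mem_Icc_four f) ψ := by
  rw [toDist_eq_hat, toDist_apply, ← integral_neg]
  refine integral_congr_ae ?_
  filter_upwards [coeFn_cutMul two_mem_Icc_four f] with ξ hξ
  rw [hξ, fourierInv_laplacian, fourierInv_cutTest]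
  push_cast; ring

theorem fracLaplacian_cutTest {σ : ℝ} (hσ : 2 * σ ∈ Icc (0 : ℝ) 4) (f : L2 n)
    (ψ : 𝓢(Rn n, ℂ)) : fracLaplacian σ f (cutTest ψ) = toDist (cutMul hσ f) ψ := by
  rw [fracLaplacian, toDist_apply]
  refine integral_congr_ae ?_
  filter_upwards [coeFn_cutMul hσ f] with ξ hξ
  rw [hξ, fourierInv_cutTest]
  push_cast; ring

/-! ### Pointwise Lyapunov inequality at a fixed frequency -/

/-- Decay rate of the frequency with `|D|²`-symbol `p` and damping symbol `d`. -/
noncomputable def rate (p d : ℝ) : ℝ := p ^ 2 / max d p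

/-- Coefficient of the correction `2 Re (v w̄)` in the Lyapunov function. -/
noncomputable def coefVW (p d : ℝ) : ℝ := if p ≤ d then p / d / 4 else 1 / 32

/-- Coefficient of the correction `2 Re (θ v̄)` in the Lyapunov function. -/
noncomputable def coefTV (p d : ℝ) : ℝ := if p ≤ d then 0 else 1 / 8

theorem coefVW_mem {p d : ℝ} (hp : 0 ≤ p) (hd : 0 ≤ d) : coefVW p d ∈ Icc (0 : ℝ) (1 / 4) := by
  unfold coefVW
  split_ifs with h
  · have h1 : p / d ≤ 1 := div_le_one_of_le₀ h hd
    have h2 : 0 ≤ p / d := div_nonneg hp hd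
    constructor <;> linarith
  · norm_num

theorem coefTV_mem (p d : ℝ) : coefTV p d ∈ Icc (0 : ℝ) (1 / 8) := by
  unfold coefTV
  split_ifs <;> norm_num

/-- The first three terms sum to `-2 d v² - 2 p θ²`. The correction by `v w` contributes `-p w²`, at
the price of `p v²` and cross terms. If `p ≤ d`, the weight `p / (4 d)` keeps the term `d v w` under
control by `d v²` and `(p² / d) w²`. If `d < p`, the correction by `θ v` contributes `-p v²`, whose
weight `1/8` outweighs the `1/32` loss from the first correction, while its `p θ²` is absorbed by
`-2 p θ²`. -/
theorem dissipation_le {p d : ℝ} (hp : 0 < p) (hd : 0 < d) (w v θ : ℝ) :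
    2 * (w * (p * v)) + 2 * (v * (-(p * w) + p * θ - d * v)) + 2 * (θ * (-(p * θ) - p * v)) +
      2 * coefVW p d * ((-(p * w) + p * θ - d * v) * w + v * (p * v)) +
      2 * coefTV p d * ((-(p * θ) - p * v) * v + θ * (-(p * w) + p * θ - d * v)) ≤
    -(rate p d / 64) * (w ^ 2 + v ^ 2 + θ ^ 2) := by
  unfold coefVW coefTV rate
  split_ifs with h
  · rw [max_eq_left h]
    obtain ⟨l, rfl⟩ : ∃ l, p = l * d := ⟨p / d, by field_simp⟩
    have hl : 0 < l := pos_of_mul_pos_left hp hd.le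
    have hl1 : l ≤ 1 := by nlinarith
    have e1 : l * d / d = l := by field_simp
    have e2 : (l * d) ^ 2 / d = l ^ 2 * d := by field_simp
    rw [e1, e2, ← sub_nonneg]
    -- With `l = p / d ≤ 1`, completing squares absorbs the products `θ w` and `v w`.
    have key : 0 ≤ d * (l * (θ - l * w / 4) ^ 2 + (v + l * w / 2) ^ 2 / 2 +
        l * (1 - l / 64) * θ ^ 2 + v ^ 2 * (3 / 2 - l ^ 2 / 2 - l ^ 2 / 64) +
        (l * w) ^ 2 * (1 / 2 - 1 / 8 - l / 16 - 1 / 64)) := by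
      have a1 : 0 ≤ 1 - l / 64 := by linarith
      have a2 : 0 ≤ 3 / 2 - l ^ 2 / 2 - l ^ 2 / 64 := by nlinarith
      have a3 : 0 ≤ 1 / 2 - 1 / 8 - l / 16 - 1 / 64 := by linarith
      positivity
    linarith
  · rw [max_eq_right (not_le.1 h).le]
    obtain ⟨m, rfl⟩ : ∃ m, d = m * p := ⟨d / p, by field_simp⟩
    have hm : 0 < m := pos_of_mul_pos_left hd hp.le
    have hm1 : m ≤ 1 := by nlinarith [not_le.1 h]
    have e2 : p ^ 2 / p = p := by field_simp
    rw [e2, ← sub_nonneg]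
    -- With `m = d / p ≤ 1`, `b1` absorbs the cross terms carrying a factor `m`; `b2` makes its
    -- leftover `w²` and `θ²` independent of `m`, so that `b3` is a fixed quadratic form.
    have b1 : 0 ≤ m * ((v + w / 32) ^ 2 + (v + θ / 8) ^ 2) := by positivity
    have b2 : 0 ≤ (1 - m) * (w ^ 2 / 1024 + θ ^ 2 / 64) :=
      mul_nonneg (by linarith) (by positivity)
    have b3 : 0 ≤ (7 / 4 - 1 / 64 - 1 / 64) * θ ^ 2 + (3 / 16 - 1 / 64) * v ^ 2 +
        (1 / 16 - 1 / 64 - 1 / 1024) * w ^ 2 + 3 / 16 * (θ * w) + 1 / 4 * (θ * v) := by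
      nlinarith [sq_nonneg (w / 8 + 3 / 4 * θ), sq_nonneg (v / 4 + θ / 2), sq_nonneg θ,
        sq_nonneg v, sq_nonneg w]
    have key := mul_nonneg hp.le (add_nonneg (add_nonneg b1 b2) b3)
    linarith

/-- Real part of the Hermitian product. -/
def dot (z w : ℂ) : ℝ := z.re * w.re + z.im * w.im

/-- Energy density. -/
def energy (w v θ : ℂ) : ℝ := dot w w + dot v v + dot θ θ

/-- Lyapunov density. -/
noncomputable def lyap (p d : ℝ) (w v θ : ℂ) : ℝ :=
  energy w v θ + 2 * coefVW p d * dot v w + 2 * coefTV p d * dot θ v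

theorem dot_self (z : ℂ) : dot z z = ‖z‖ ^ 2 := by
  rw [dot, Complex.sq_norm, Complex.normSq_apply]

theorem abs_two_mul_dot_le (z w : ℂ) : |2 * dot z w| ≤ dot z z + dot w w := by
  unfold dot
  rw [abs_le]
  constructor <;>
    nlinarith [sq_nonneg (z.re + w.re), sq_nonneg (z.im + w.im), sq_nonneg (z.re - w.re),
      sq_nonneg (z.im - w.im)]

theorem dot_self_nonneg (z : ℂ) : 0 ≤ dot z z := by rw [dot_self]; positivity

theorem energy_nonneg (w v θ : ℂ) : 0 ≤ energy w v θ := by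
  have := dot_self_nonneg w; have := dot_self_nonneg v; have := dot_self_nonneg θ
  unfold energy; positivity

/-- The correction weights are at most `1/4` and `1/8`, so the Lyapunov density lies between `1/2`
and `3/2` of the energy. -/
theorem abs_lyap_sub_energy_le {p d : ℝ} (hp : 0 ≤ p) (hd : 0 ≤ d) (w v θ : ℂ) :
    |lyap p d w v θ - energy w v θ| ≤ energy w v θ / 2 := by
  have h1 := abs_two_mul_dot_le v w
  have h2 := abs_two_mul_dot_le θ v
  have ha := coefVW_mem hp hd
  have hb := coefTV_mem p d
  have e : lyap p d w v θ - energy w v θ =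
      coefVW p d * (2 * dot v w) + coefTV p d * (2 * dot θ v) := by unfold lyap; ring
  have := dot_self_nonneg w; have := dot_self_nonneg v; have := dot_self_nonneg θ
  rw [e]
  calc _ ≤ |coefVW p d * (2 * dot v w)| + |coefTV p d * (2 * dot θ v)| := abs_add_le _ _
    _ = coefVW p d * |2 * dot v w| + coefTV p d * |2 * dot θ v| := by
      rw [abs_mul (coefVW p d), abs_mul (coefTV p d), abs_of_nonneg ha.1, abs_of_nonneg hb.1]
    _ ≤ 1 / 4 * (dot v v + dot w w) + 1 / 8 * (dot θ θ + dot v v) := by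
      gcongr
      · exact ha.2
      · exact hb.2
    _ ≤ _ := by unfold energy; linarith

/-- The real inequality is applied to real and imaginary parts; `96 = 64 * 3/2` accounts for `lyap ≤
(3/2) energy`. -/
theorem lyap_deriv_le {p d : ℝ} (hp : 0 < p) (hd : 0 < d) (w v θ : ℂ) :
    2 * dot w (p * v) + 2 * dot v (-(p * w) + p * θ - d * v) + 2 * dot θ (-(p * θ) - p * v) +
      2 * coefVW p d * (dot (-(p * w) + p * θ - d * v) w + dot v (p * v)) +
      2 * coefTV p d * (dot (-(p * θ) - p * v) v + dot θ (-(p * w) + p * θ - d * v)) ≤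
    -(rate p d / 96) * lyap p d w v θ := by
  have h1 := dissipation_le hp hd w.re v.re θ.re
  have h2 := dissipation_le hp hd w.im v.im θ.im
  have h3 := (abs_le.1 (abs_lyap_sub_energy_le hp.le hd.le w v θ)).2
  have hr : 0 ≤ rate p d := by unfold rate; positivity
  have h4 : rate p d / 96 * lyap p d w v θ ≤ rate p d / 64 * energy w v θ := by
    nlinarith
  have h5 : -(rate p d / 64) * energy w v θ ≤ -(rate p d / 96) * lyap p d w v θ := by linarith
  refine le_trans ?_ h5
  simp only [energy, dot, Complex.add_re, Complex.sub_re, Complex.neg_re, Complex.add_im,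
    Complex.sub_im, Complex.neg_im, Complex.re_ofReal_mul, Complex.im_ofReal_mul]
  linarith

/-! ### The weighted evolution equations in `L²` -/

variable {σ : ℝ} {u₀ : 𝓢'(Rn n, ℂ)} {u₁ θ₀ : L2 n} {u : ℝ → 𝓢'(Rn n, ℂ)} {w v θ : ℝ → L2 n}

namespace IsSolution

theorem u_laplacian (h : IsSolution σ u₀ u₁ θ₀ u w v θ) {t : ℝ} (ht : 0 ≤ t) (φ : 𝓢(Rn n, ℂ)) :
    u t (Δ φ) = -toDist (w t) φ := by
  rw [← h.neg_laplacian_eq t ht, ← TemperedDistribution.laplacian_apply_apply]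
  exact (neg_neg _).symm

theorem hasDerivAt_cut_w (h : IsSolution σ u₀ u₁ θ₀ u w v θ) {t : ℝ} (ht : 0 < t) :
    HasDerivAt (fun τ => cutMul zero_mem_Icc_four (w τ)) (cutMul two_mem_Icc_four (v t)) t := by
  refine hasDerivAt_of_toDist (Z := fun τ => cutMul two_mem_Icc_four (v τ)) ?_ ?_ ht
  · exact ((continuous_cutMul _).comp_continuousOn h.continuousOn_v).mono Ioi_subset_Ici_self
  · intro ψ t ht
    -- Since `w = -Δu`, its equation is that of `u` tested against a Laplacian.
    have hd := (h.hasDerivAt_u (Δ (cutTest ψ)) t ht).neg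
    rw [toDist_laplacian_cutTest, neg_neg] at hd
    refine hd.congr_of_eventuallyEq ?_
    filter_upwards [Ioi_mem_nhds ht] with τ hτ
    rw [← toDist_cutTest, Pi.neg_apply, h.u_laplacian hτ.le, neg_neg]

theorem hasDerivAt_cut_v (h : IsSolution σ u₀ u₁ θ₀ u w v θ) (hσ : 2 * σ ∈ Icc (0 : ℝ) 4)
    {t : ℝ} (ht : 0 < t) :
    HasDerivAt (fun τ => cutMul zero_mem_Icc_four (v τ))
      (-cutMul two_mem_Icc_four (w t) + cutMul two_mem_Icc_four (θ t) - cutMul hσ (v t)) t := by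
  refine hasDerivAt_of_toDist (Z := fun t => -cutMul two_mem_Icc_four (w t) +
    cutMul two_mem_Icc_four (θ t) - cutMul hσ (v t)) ?_ ?_ ht
  · refine ContinuousOn.mono ?_ Ioi_subset_Ici_self
    exact (((continuous_cutMul _).comp_continuousOn h.continuousOn_w).neg.add
      ((continuous_cutMul _).comp_continuousOn h.continuousOn_θ)).sub
      ((continuous_cutMul _).comp_continuousOn h.continuousOn_v)
  · intro ψ t ht
    have hd := h.hasDerivAt_v (cutTest ψ) t ht
    simp only [toDist_cutTest] at hd
    convert! hd using 1
    rw [TemperedDistribution.laplacian_apply_apply, TemperedDistribution.laplacian_apply_apply,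
      TemperedDistribution.laplacian_apply_apply, h.u_laplacian ht.le, toDist_laplacian_cutTest,
      toDist_laplacian_cutTest, fracLaplacian_cutTest hσ]
    simp only [← testCLM_apply, map_add, map_sub, map_neg]
    ring

theorem hasDerivAt_cut_θ (h : IsSolution σ u₀ u₁ θ₀ u w v θ) {t : ℝ} (ht : 0 < t) :
    HasDerivAt (fun τ => cutMul zero_mem_Icc_four (θ τ))
      (-cutMul two_mem_Icc_four (θ t) - cutMul two_mem_Icc_four (v t)) t := by
  refine hasDerivAt_of_toDist (Z := fun t => -cutMul two_mem_Icc_four (θ t) -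
    cutMul two_mem_Icc_four (v t)) ?_ ?_ ht
  · refine ContinuousOn.mono ?_ Ioi_subset_Ici_self
    exact ((continuous_cutMul _).comp_continuousOn h.continuousOn_θ).neg.sub
      ((continuous_cutMul _).comp_continuousOn h.continuousOn_v)
  · intro ψ t ht
    have hd := h.hasDerivAt_θ (cutTest ψ) t ht
    simp only [toDist_cutTest] at hd
    convert! hd using 1
    rw [TemperedDistribution.laplacian_apply_apply, TemperedDistribution.laplacian_apply_apply,
      toDist_laplacian_cutTest, toDist_laplacian_cutTest]
    simp only [← testCLM_apply, map_sub, map_neg]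
    ring

end IsSolution

/-! ### From integrated Lyapunov decay to almost every frequency -/

/-- `F` is integrable with integral `q`. -/
def HasIntegral (F : Rn n → ℝ) (q : ℝ) : Prop := Integrable F ∧ ∫ x, F x = q

theorem HasIntegral.add {F G : Rn n → ℝ} {p q : ℝ} (hF : HasIntegral F p)
    (hG : HasIntegral G q) : HasIntegral (fun x => F x + G x) (p + q) :=
  ⟨hF.1.add hG.1, by rw [integral_add hF.1 hG.1, hF.2, hG.2]⟩

theorem HasIntegral.const_mul {F : Rn n → ℝ} {q : ℝ} (hF : HasIntegral F q) (c : ℝ) :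
    HasIntegral (fun x => c * F x) (c * q) :=
  ⟨hF.1.const_mul c, by rw [integral_const_mul, hF.2]⟩

/-- The weighted real inner product `∫ m Re (f ḡ)`. -/
noncomputable def wInner {m : Rn n → ℝ} (hm : MemLp m ∞ volume) (f g : L2 n) : ℝ :=
  inner ℝ f (mulL hm g)

theorem hasIntegral_wInner {m : Rn n → ℝ} (hm : MemLp m ∞ volume) (f g : L2 n) :
    HasIntegral (fun x => m x * dot (f x) (g x)) (wInner hm f g) := by
  have e : (fun x => inner ℝ (f x) ((mulL hm g) x)) =ᵐ[volume]
      fun x => m x * dot (f x) (g x) := by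
    filter_upwards [coeFn_mulL hm g] with x hx
    rw [hx, Complex.inner, dot]
    simp
    ring
  refine ⟨(L2.integrable_inner (𝕜 := ℝ) f (mulL hm g)).congr e, ?_⟩
  rw [← integral_congr_ae e]
  rfl

theorem hasDerivAt_wInner {m : Rn n → ℝ} (hm : MemLp m ∞ volume) {f g : ℝ → L2 n} {f' g' : L2 n}
    {t : ℝ} (hf : HasDerivAt f f' t) (hg : HasDerivAt g g' t) :
    HasDerivAt (fun τ => wInner hm (f τ) (g τ)) (wInner hm (f t) g' + wInner hm f' (g t)) t :=
  hf.inner ℝ ((mulL hm).hasFDerivAt.comp_hasDerivAt t hg)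

theorem continuousOn_wInner {m : Rn n → ℝ} (hm : MemLp m ∞ volume) {f g : ℝ → L2 n}
    {s : Set ℝ} (hf : ContinuousOn f s) (hg : ContinuousOn g s) :
    ContinuousOn (fun τ => wInner hm (f τ) (g τ)) s :=
  hf.inner ((mulL hm).continuous.comp_continuousOn hg)

/-- The symbol of `(-Δ)^{β/2}`. -/
noncomputable def symb (β : ℝ) (ξ : Rn n) : ℝ := (2 * Real.pi * ‖ξ‖) ^ β

theorem measurable_symb (β : ℝ) : Measurable (symb β : Rn n → ℝ) := by unfold symb; fun_prop

theorem symb_nonneg (β : ℝ) (ξ : Rn n) : 0 ≤ symb β ξ := by unfold symb; positivity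

theorem measurable_rate (σ : ℝ) :
    Measurable fun ξ : Rn n => rate (symb 2 ξ) (symb (2 * σ) ξ) := by
  have := measurable_symb (n := n) 2
  have := measurable_symb (n := n) (2 * σ)
  unfold rate; fun_prop

theorem measurable_coefVW (σ : ℝ) :
    Measurable fun ξ : Rn n => coefVW (symb 2 ξ) (symb (2 * σ) ξ) := by
  have h1 := measurable_symb (n := n) 2
  have h2 := measurable_symb (n := n) (2 * σ)
  exact Measurable.ite (measurableSet_le h1 h2) ((h1.div h2).div_const _) measurable_const

theorem measurable_coefTV (σ : ℝ) :
    Measurable fun ξ : Rn n => coefTV (symb 2 ξ) (symb (2 * σ) ξ) :=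
  Measurable.ite (measurableSet_le (measurable_symb 2) (measurable_symb (2 * σ)))
    measurable_const measurable_const

theorem memLp_top_indicator_mul {A : Set (Rn n)} (hA : MeasurableSet A) {f : Rn n → ℝ}
    (hf : Measurable f) {C : ℝ} (h : ∀ x, f x ∈ Icc 0 C) :
    MemLp (fun x => A.indicator 1 x * f x) ∞ volume := by
  refine memLp_top_of_bound (C := C) ?_ (Eventually.of_forall fun x => ?_)
  · exact ((measurable_one.indicator hA).mul hf).aestronglyMeasurable
  · have := h x
    by_cases hx : x ∈ A
    · simpa [hx, abs_of_nonneg this.1] using this.2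
    · simpa [hx] using this.1.trans this.2

theorem hasIntegral_lyap_wInner (σ : ℝ) {A : Set (Rn n)}
    (m₁ : MemLp (fun ξ : Rn n => A.indicator 1 ξ * (1 : Rn n → ℝ) ξ) ∞ volume)
    (m₂ : MemLp (fun ξ : Rn n => A.indicator 1 ξ * coefVW (symb 2 ξ) (symb (2 * σ) ξ)) ∞ volume)
    (m₃ : MemLp (fun ξ : Rn n => A.indicator 1 ξ * coefTV (symb 2 ξ) (symb (2 * σ) ξ)) ∞ volume)
    (f g h : L2 n) :
    HasIntegral (fun ξ => A.indicator 1 ξ * lyap (symb 2 ξ) (symb (2 * σ) ξ) (f ξ) (g ξ) (h ξ))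
      (wInner m₁ f f + wInner m₁ g g + wInner m₁ h h + 2 * wInner m₂ g f + 2 * wInner m₃ h g) := by
  have key := ((((hasIntegral_wInner m₁ f f).add (hasIntegral_wInner m₁ g g)).add
    (hasIntegral_wInner m₁ h h)).add ((hasIntegral_wInner m₂ g f).const_mul 2)).add
    ((hasIntegral_wInner m₃ h g).const_mul 2)
  convert! key using 1
  ext ξ
  simp only [lyap, energy, Pi.one_apply]
  ring

theorem integrable_lyap (σ : ℝ) (f g h : L2 n) :
    Integrable fun ξ => lyap (symb 2 ξ) (symb (2 * σ) ξ) (f ξ) (g ξ) (h ξ) := by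
  have key := (hasIntegral_lyap_wInner σ
    (memLp_top_indicator_mul MeasurableSet.univ measurable_one (C := 1) (by simp))
    (memLp_top_indicator_mul MeasurableSet.univ (measurable_coefVW σ)
      (fun ξ => coefVW_mem (symb_nonneg 2 ξ) (symb_nonneg (2 * σ) ξ)))
    (memLp_top_indicator_mul MeasurableSet.univ (measurable_coefTV σ)
      (fun ξ => coefTV_mem (symb 2 ξ) (symb (2 * σ) ξ))) f g h).1
  simpa using key

theorem ae_ne_zero (hn : 1 ≤ n) : ∀ᵐ ξ : Rn n, ξ ≠ 0 := by
  have : Nonempty (Fin n) := ⟨⟨0, hn⟩⟩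
  exact Measure.ae_ne volume 0

/-- The Lyapunov functional on frequencies in `A`. -/
noncomputable def lyapInt (σ : ℝ) (A : Set (Rn n)) (f g h : L2 n) : ℝ :=
  ∫ ξ in A, lyap (symb 2 ξ) (symb (2 * σ) ξ) (cutMul zero_mem_Icc_four f ξ)
    (cutMul zero_mem_Icc_four g ξ) (cutMul zero_mem_Icc_four h ξ)

/-- Gronwall's argument: on `A` the density satisfies `lyap' ≤ -k lyap`, so `exp (k t)` times the
functional is nonincreasing. Differentiability is needed only for `t > 0`, with continuity up to
`0`. The set `A` stays arbitrary so that the bound can be localised. -/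
theorem lyapInt_le (hn : 1 ≤ n) (h : IsSolution σ u₀ u₁ θ₀ u w v θ)
    (hσ : 2 * σ ∈ Icc (0 : ℝ) 4) {A : Set (Rn n)} (hA : MeasurableSet A) {k : ℝ}
    (hkA : ∀ ξ ∈ A, k ≤ rate (symb 2 ξ) (symb (2 * σ) ξ) / 96) {t : ℝ} (ht : 0 ≤ t) :
    lyapInt σ A (w t) (v t) (θ t) ≤ Real.exp (-(k * t)) * lyapInt σ A (w 0) (v 0) (θ 0) := by
  have m1 := memLp_top_indicator_mul hA measurable_one (C := 1) (by simp)
  have m2 := memLp_top_indicator_mul hA (measurable_coefVW σ)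
    (fun ξ => coefVW_mem (symb_nonneg 2 ξ) (symb_nonneg (2 * σ) ξ))
  have m3 := memLp_top_indicator_mul hA (measurable_coefTV σ)
    (fun ξ => coefTV_mem (symb 2 ξ) (symb (2 * σ) ξ))
  set W := fun τ => cutMul zero_mem_Icc_four (w τ) with hW
  set V := fun τ => cutMul zero_mem_Icc_four (v τ) with hV
  set T := fun τ => cutMul zero_mem_Icc_four (θ τ) with hT
  set G : ℝ → ℝ := fun τ => wInner m1 (W τ) (W τ) + wInner m1 (V τ) (V τ) +
    wInner m1 (T τ) (T τ) + 2 * wInner m2 (V τ) (W τ) + 2 * wInner m3 (T τ) (V τ) with hG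
  have lyap_repr : ∀ τ, HasIntegral (fun ξ => A.indicator 1 ξ *
      lyap (symb 2 ξ) (symb (2 * σ) ξ) (W τ ξ) (V τ ξ) (T τ ξ)) (G τ) :=
    fun τ => hasIntegral_lyap_wInner σ m1 m2 m3 (W τ) (V τ) (T τ)
  have hGI : ∀ τ, lyapInt σ A (w τ) (v τ) (θ τ) = G τ := by
    intro τ
    rw [← (lyap_repr τ).2, lyapInt, ← integral_indicator hA]
    congr 1
    ext ξ
    by_cases hξ : ξ ∈ A <;> simp [hξ, hW, hV, hT]
  have hWc : ContinuousOn W (Ici 0) := (continuous_cutMul _).comp_continuousOn h.continuousOn_w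
  have hVc : ContinuousOn V (Ici 0) := (continuous_cutMul _).comp_continuousOn h.continuousOn_v
  have hTc : ContinuousOn T (Ici 0) := (continuous_cutMul _).comp_continuousOn h.continuousOn_θ
  have hGc : ContinuousOn G (Ici 0) :=
    ((((continuousOn_wInner m1 hWc hWc).add (continuousOn_wInner m1 hVc hVc)).add
      (continuousOn_wInner m1 hTc hTc)).add
      (continuousOn_const.mul (continuousOn_wInner m2 hVc hWc))).add
      (continuousOn_const.mul (continuousOn_wInner m3 hTc hVc))
  have hGd : ∀ τ, 0 < τ → ∃ G', HasDerivAt G G' τ ∧ G' + k * G τ ≤ 0 := by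
    intro τ hτ
    have dW := h.hasDerivAt_cut_w hτ
    have dV := h.hasDerivAt_cut_v hσ hτ
    have dT := h.hasDerivAt_cut_θ hτ
    set W' := cutMul two_mem_Icc_four (v τ) with hW'
    set V' := -cutMul two_mem_Icc_four (w τ) + cutMul two_mem_Icc_four (θ τ) -
      cutMul hσ (v τ) with hV'
    set T' := -cutMul two_mem_Icc_four (θ τ) - cutMul two_mem_Icc_four (v τ) with hT'
    refine ⟨_, ((((hasDerivAt_wInner m1 dW dW).add (hasDerivAt_wInner m1 dV dV)).add
      (hasDerivAt_wInner m1 dT dT)).add ((hasDerivAt_wInner m2 dV dW).const_mul 2)).add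
      ((hasDerivAt_wInner m3 dT dV).const_mul 2), ?_⟩
    -- This expresses `G' + k G` as a single integral, whose integrand is nonpositive almost
    -- everywhere.
    have key := (((((
      (hasIntegral_wInner m1 (W τ) W').add (hasIntegral_wInner m1 W' (W τ))).add
      ((hasIntegral_wInner m1 (V τ) V').add (hasIntegral_wInner m1 V' (V τ)))).add
      ((hasIntegral_wInner m1 (T τ) T').add (hasIntegral_wInner m1 T' (T τ)))).add
      (((hasIntegral_wInner m2 (V τ) W').add (hasIntegral_wInner m2 V' (W τ))).const_mul 2)).add
      (((hasIntegral_wInner m3 (T τ) V').add (hasIntegral_wInner m3 T' (V τ))).const_mul 2)).add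
      ((lyap_repr τ).const_mul k)
    refine key.2.symm.trans_le (integral_nonpos_of_ae ?_)
    filter_upwards [ae_ne_zero hn, coeFn_cutMul two_mem_Icc_four (v τ),
      coeFn_cutMul two_mem_Icc_four (w τ), coeFn_cutMul two_mem_Icc_four (θ τ),
      coeFn_cutMul hσ (v τ), coeFn_cutMul zero_mem_Icc_four (v τ),
      coeFn_cutMul zero_mem_Icc_four (w τ), coeFn_cutMul zero_mem_Icc_four (θ τ),
      Lp.coeFn_sub (-cutMul two_mem_Icc_four (w τ) + cutMul two_mem_Icc_four (θ τ))
        (cutMul hσ (v τ)),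
      Lp.coeFn_add (-cutMul two_mem_Icc_four (w τ)) (cutMul two_mem_Icc_four (θ τ)),
      Lp.coeFn_neg (cutMul two_mem_Icc_four (w τ)),
      Lp.coeFn_sub (-cutMul two_mem_Icc_four (θ τ)) (cutMul two_mem_Icc_four (v τ)),
      Lp.coeFn_neg (cutMul two_mem_Icc_four (θ τ))]
      with ξ hξ v2 w2 t2 vs v0 w0 t0 s1 s2 s3 s4 s5
    have r0 : 0 < 2 * Real.pi * ‖ξ‖ := by positivity
    have eW' : W' ξ = (symb 2 ξ : ℂ) * V τ ξ := by
      simp only [hW', hV, v2, v0, symb, Real.rpow_zero]; push_cast; ring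
    have eV' : V' ξ = -((symb 2 ξ : ℂ) * W τ ξ) + (symb 2 ξ : ℂ) * T τ ξ -
        (symb (2 * σ) ξ : ℂ) * V τ ξ := by
      simp only [hV', s1, s2, s3, Pi.sub_apply, Pi.add_apply, Pi.neg_apply, hW, hV, hT, w2, t2, vs,
        v0, w0, t0, symb, Real.rpow_zero]
      push_cast; ring
    have eT' : T' ξ = -((symb 2 ξ : ℂ) * T τ ξ) - (symb 2 ξ : ℂ) * V τ ξ := by
      simp only [hT', s4, s5, Pi.sub_apply, Pi.neg_apply, hV, hT, t2, v2, v0, t0, symb,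
        Real.rpow_zero]
      push_cast; ring
    rw [Pi.zero_apply]
    by_cases hmem : ξ ∈ A
    · have hp : 0 < symb 2 ξ := Real.rpow_pos_of_pos r0 _
      have hd : 0 < symb (2 * σ) ξ := Real.rpow_pos_of_pos r0 _
      have hle := lyap_deriv_le hp hd (W τ ξ) (V τ ξ) (T τ ξ)
      have hlow := (abs_le.1 (abs_lyap_sub_energy_le hp.le hd.le (W τ ξ) (V τ ξ) (T τ ξ))).1
      have hen := energy_nonneg (W τ ξ) (V τ ξ) (T τ ξ)
      have hkk : k * lyap (symb 2 ξ) (symb (2 * σ) ξ) (W τ ξ) (V τ ξ) (T τ ξ) ≤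
          rate (symb 2 ξ) (symb (2 * σ) ξ) / 96 *
            lyap (symb 2 ξ) (symb (2 * σ) ξ) (W τ ξ) (V τ ξ) (T τ ξ) :=
        mul_le_mul_of_nonneg_right (hkA ξ hmem) (by linarith)
      have hcomm : ∀ a b : ℂ, dot a b = dot b a := fun a b => by unfold dot; ring
      rw [← eT', ← eV', ← eW'] at hle
      simp only [Set.indicator_of_mem hmem, Pi.one_apply, one_mul]
      rw [hcomm (W' ξ) _, hcomm (V' ξ) (V τ ξ), hcomm (T' ξ) (T τ ξ)]
      linarith
    · simp [Set.indicator_of_notMem hmem]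
  have hanti : AntitoneOn (fun τ => Real.exp (k * τ) * G τ) (Ici 0) := by
    have hd : ∀ τ ∈ interior (Ici (0 : ℝ)), ∃ D, HasDerivAt (fun τ => Real.exp (k * τ) * G τ) D τ ∧
        D ≤ 0 := by
      intro τ hτ
      rw [interior_Ici] at hτ
      obtain ⟨G', h1, h2⟩ := hGd τ hτ
      refine ⟨_, (((hasDerivAt_id τ).const_mul k).exp).mul h1, ?_⟩
      have : 0 ≤ Real.exp (k * τ) := (Real.exp_pos _).le
      simp only [id, mul_one]
      nlinarith
    refine antitoneOn_of_deriv_nonpos (convex_Ici 0) ?_ ?_ ?_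
    · exact (Continuous.continuousOn (by fun_prop)).mul hGc
    · intro τ hτ
      obtain ⟨D, h1, -⟩ := hd τ hτ
      exact h1.differentiableAt.differentiableWithinAt
    · intro τ hτ
      obtain ⟨D, h1, h2⟩ := hd τ hτ
      rw [h1.deriv]; exact h2
  have := hanti (mem_Ici.2 le_rfl) ht ht
  simp only [mul_zero, Real.exp_zero, one_mul] at this
  rw [hGI, hGI]
  calc G t = Real.exp (-(k * t)) * (Real.exp (k * t) * G t) := by
        rw [← mul_assoc, ← Real.exp_add]; simp
    _ ≤ _ := by gcongr

theorem ae_lyap_le_of_le_rate (hn : 1 ≤ n) (h : IsSolution σ u₀ u₁ θ₀ u w v θ)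
    (hσ : 2 * σ ∈ Icc (0 : ℝ) 4) (k : ℝ) {t : ℝ} (ht : 0 ≤ t) :
    ∀ᵐ ξ : Rn n, k ≤ rate (symb 2 ξ) (symb (2 * σ) ξ) / 96 →
      lyap (symb 2 ξ) (symb (2 * σ) ξ) (cutMul zero_mem_Icc_four (w t) ξ)
        (cutMul zero_mem_Icc_four (v t) ξ) (cutMul zero_mem_Icc_four (θ t) ξ) ≤
      Real.exp (-(k * t)) *
        lyap (symb 2 ξ) (symb (2 * σ) ξ) (cutMul zero_mem_Icc_four (w 0) ξ)
        (cutMul zero_mem_Icc_four (v 0) ξ) (cutMul zero_mem_Icc_four (θ 0) ξ) := by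
  set S := {ξ : Rn n | k ≤ rate (symb 2 ξ) (symb (2 * σ) ξ) / 96} with hS
  have hSm : MeasurableSet S := measurableSet_le measurable_const ((measurable_rate σ).div_const _)
  have hint : ∀ t, Integrable fun ξ : Rn n =>
      lyap (symb 2 ξ) (symb (2 * σ) ξ) (cutMul zero_mem_Icc_four (w t) ξ)
        (cutMul zero_mem_Icc_four (v t) ξ) (cutMul zero_mem_Icc_four (θ t) ξ) :=
    fun t => integrable_lyap σ _ _ _
  refine (ae_restrict_iff' hSm).1 ?_
  refine ae_le_of_forall_setIntegral_le (hint t).integrableOn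
    -- The integral inequality on every measurable subset of `S` forces the pointwise one.
    ((hint 0).const_mul (Real.exp (-(k * t)))).integrableOn fun s hs _ => ?_
  rw [Measure.restrict_restrict hs, integral_const_mul]
  exact lyapInt_le hn h hσ (hs.inter hSm) (fun ξ hξ => hξ.2) ht

theorem ae_energy_hat_le (hn : 1 ≤ n) (h : IsSolution σ u₀ u₁ θ₀ u w v θ)
    (hσ : 2 * σ ∈ Icc (0 : ℝ) 4) {t : ℝ} (ht : 0 ≤ t) :
    ∀ᵐ ξ : Rn n, energy (hat (w t) ξ) (hat (v t) ξ) (hat (θ t) ξ) ≤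
      3 * Real.exp (-(rate (symb 2 ξ) (symb (2 * σ) ξ) / 96 * t)) *
        energy (hat (w 0) ξ) (hat (v 0) ξ) (hat (θ 0) ξ) := by
  -- The exceptional null set depends on `k`: countably many rational values are used, then `k`
  -- tends to the rate from below.
  have hall := ae_all_iff.2 fun q : ℚ => ae_lyap_le_of_le_rate hn h hσ (q : ℝ) ht
  filter_upwards [hall, coeFn_cutMul zero_mem_Icc_four (w t), coeFn_cutMul zero_mem_Icc_four (v t),
    coeFn_cutMul zero_mem_Icc_four (θ t), coeFn_cutMul zero_mem_Icc_four (w 0),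
    coeFn_cutMul zero_mem_Icc_four (v 0), coeFn_cutMul zero_mem_Icc_four (θ 0)]
    with ξ hξ e1 e2 e3 e4 e5 e6
  set p := symb 2 ξ
  set d := symb (2 * σ) ξ
  have hlim : ∀ k : ℝ, k < rate p d / 96 →
      lyap p d (cutMul zero_mem_Icc_four (w t) ξ) (cutMul zero_mem_Icc_four (v t) ξ)
        (cutMul zero_mem_Icc_four (θ t) ξ) ≤ Real.exp (-(k * t)) *
      lyap p d (cutMul zero_mem_Icc_four (w 0) ξ) (cutMul zero_mem_Icc_four (v 0) ξ)
        (cutMul zero_mem_Icc_four (θ 0) ξ) := by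
    intro k hk
    obtain ⟨q, hq1, hq2⟩ := exists_rat_btwn hk
    refine (hξ q hq2.le).trans ?_
    have h1 := (abs_le.1 (abs_lyap_sub_energy_le (symb_nonneg 2 ξ) (symb_nonneg (2 * σ) ξ)
      (cutMul zero_mem_Icc_four (w 0) ξ) (cutMul zero_mem_Icc_four (v 0) ξ)
        (cutMul zero_mem_Icc_four (θ 0) ξ))).1
    have h2 := energy_nonneg (cutMul zero_mem_Icc_four (w 0) ξ)
      (cutMul zero_mem_Icc_four (v 0) ξ) (cutMul zero_mem_Icc_four (θ 0) ξ)
    refine mul_le_mul_of_nonneg_right (Real.exp_le_exp.2 ?_) (by linarith)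
    nlinarith
  have hle : lyap p d (cutMul zero_mem_Icc_four (w t) ξ) (cutMul zero_mem_Icc_four (v t) ξ)
        (cutMul zero_mem_Icc_four (θ t) ξ) ≤ Real.exp (-(rate p d / 96 * t)) *
      lyap p d (cutMul zero_mem_Icc_four (w 0) ξ) (cutMul zero_mem_Icc_four (v 0) ξ)
        (cutMul zero_mem_Icc_four (θ 0) ξ) := by
    have hc : Continuous fun k : ℝ => Real.exp (-(k * t)) *
      lyap p d (cutMul zero_mem_Icc_four (w 0) ξ) (cutMul zero_mem_Icc_four (v 0) ξ)
        (cutMul zero_mem_Icc_four (θ 0) ξ) := by fun_prop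
    refine ge_of_tendsto (hc.continuousWithinAt (s := Iio (rate p d / 96))) ?_
    filter_upwards [self_mem_nhdsWithin] with k hk using hlim k hk
  have hsc : ∀ a b c : ℂ, energy (((2 * Real.pi * ‖ξ‖) ^ (0 : ℝ) * cutoff ξ : ℝ) * a)
      (((2 * Real.pi * ‖ξ‖) ^ (0 : ℝ) * cutoff ξ : ℝ) * b)
      (((2 * Real.pi * ‖ξ‖) ^ (0 : ℝ) * cutoff ξ : ℝ) * c) = cutoff ξ ^ 2 * energy a b c := by
    intro a b c
    rw [Real.rpow_zero, one_mul]
    simp only [energy, dot, Complex.re_ofReal_mul, Complex.im_ofReal_mul]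
    ring
  rw [e1, e2, e3, e4, e5, e6] at hle
  -- Comparing `lyap` with the energy at both times costs `(3/2) / (1/2) = 3`; the common factor
  -- `cutoff ξ ^ 2` then cancels.
  have h1 := (abs_le.1 (abs_lyap_sub_energy_le (symb_nonneg 2 ξ) (symb_nonneg (2 * σ) ξ) _ _ _)).1.trans
    (sub_le_sub_right hle _)
  have h2 := (abs_le.1 (abs_lyap_sub_energy_le (symb_nonneg 2 ξ) (symb_nonneg (2 * σ) ξ)
    (((2 * Real.pi * ‖ξ‖) ^ (0 : ℝ) * cutoff ξ : ℝ) * hat (w 0) ξ)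
    (((2 * Real.pi * ‖ξ‖) ^ (0 : ℝ) * cutoff ξ : ℝ) * hat (v 0) ξ)
    (((2 * Real.pi * ‖ξ‖) ^ (0 : ℝ) * cutoff ξ : ℝ) * hat (θ 0) ξ))).2
  rw [hsc] at h1 h2
  have hE := Real.exp_pos (-(rate p d / 96 * t))
  have h3 := mul_le_mul_of_nonneg_left h2 hE.le
  have hc : 0 < cutoff ξ ^ 2 := pow_pos (cutoff_pos ξ) 2
  refine le_of_mul_le_mul_left ?_ hc
  linarith

theorem norm_le_of_energy_le {a b c a' b' c' : ℂ} {x : ℝ}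
    (h : energy a b c ≤ 3 * Real.exp (-(2 * x)) * energy a' b' c') (z : ℂ)
    (hz : z = a ∨ z = b ∨ z = c) :
    ‖z‖ ≤ 2 * Real.exp (-x) * (‖a'‖ + ‖b'‖ + ‖c'‖) := by
  simp only [energy, dot_self] at h
  have h1 : ‖z‖ ^ 2 ≤ ‖a‖ ^ 2 + ‖b‖ ^ 2 + ‖c‖ ^ 2 := by
    rcases hz with h | h | h <;> rw [h] <;> nlinarith [sq_nonneg ‖a‖, sq_nonneg ‖b‖, sq_nonneg ‖c‖]
  have h2 : Real.exp (-(2 * x)) = Real.exp (-x) ^ 2 := by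
    rw [← Real.exp_nat_mul]; congr 1; push_cast; ring
  have h3 : ‖a'‖ ^ 2 + ‖b'‖ ^ 2 + ‖c'‖ ^ 2 ≤ (‖a'‖ + ‖b'‖ + ‖c'‖) ^ 2 := by
    nlinarith [mul_nonneg (norm_nonneg a') (norm_nonneg b'),
      mul_nonneg (norm_nonneg a') (norm_nonneg c'), mul_nonneg (norm_nonneg b') (norm_nonneg c')]
  refine le_of_sq_le_sq ?_ (by positivity)
  rw [h2] at h
  have h4 := mul_le_mul_of_nonneg_left h3 (sq_nonneg (Real.exp (-x)))
  have h5 : 0 ≤ (Real.exp (-x) * (‖a'‖ + ‖b'‖ + ‖c'‖)) ^ 2 := sq_nonneg _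
  nlinarith

/-! ### Low-frequency expansion of the transform of `L^{1,δ}` data -/

/-- The `L²` Fourier transform of an integrable function is given by the Fourier integral. -/
theorem hat_ae_eq_fourier {f : L2 n} (hf : MemLp f 1 volume) :
    hat f =ᵐ[volume] 𝓕 (f : Rn n → ℂ) := by
  have hfi : Integrable (f : Rn n → ℂ) := memLp_one_iff_integrable.1 hf
  have hcont : Continuous (𝓕 (f : Rn n → ℂ)) :=
    VectorFourier.fourierIntegral_continuous Real.continuous_fourierChar
      (continuous_inner : Continuous fun p : Rn n × Rn n => inner ℝ p.1 p.2) hfi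
  have hloc : LocallyIntegrable (fun ξ => hat f ξ - 𝓕 (f : Rn n → ℂ) ξ) volume :=
    ((Lp.memLp (hat f)).locallyIntegrable one_le_two).sub hcont.locallyIntegrable
  suffices h : ∀ᵐ ξ, hat f ξ - 𝓕 (f : Rn n → ℂ) ξ = 0 by
    filter_upwards [h] with ξ hξ using sub_eq_zero.1 hξ
  refine ae_eq_zero_of_integral_contDiff_smul_eq_zero hloc fun g hg hgc => ?_
  have hg₁ : HasCompactSupport (Complex.ofRealCLM ∘ g) := hgc.comp_left rfl
  have hg₂ : ContDiff ℝ ((⊤ : ℕ∞) : WithTop ℕ∞) (Complex.ofRealCLM ∘ g) :=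
    Complex.ofRealCLM.contDiff.comp hg
  set ψ : 𝓢(Rn n, ℂ) := hg₁.toSchwartzMap hg₂ with hψ
  have hψg : ∀ ξ, ψ ξ = (g ξ : ℂ) := fun ξ => rfl
  have e1 : ∫ ξ, ψ ξ * hat f ξ = ∫ x, (𝓕 ψ : 𝓢(Rn n, ℂ)) x * f x := by
    rw [← toDist_apply f, toDist_eq_hat, FourierTransform.fourierInv_fourier_eq]
  -- The multiplication formula moves the Fourier integral from the Schwartz function to `f`.
  have e2 : ∫ x, (𝓕 ψ : 𝓢(Rn n, ℂ)) x * f x = ∫ ξ, ψ ξ * 𝓕 (f : Rn n → ℂ) ξ := by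
    have := VectorFourier.integral_fourierIntegral_smul_eq_flip (μ := volume) (ν := volume)
      (L := innerₗ (Rn n)) (f := ψ) (g := (f : Rn n → ℂ)) Real.continuous_fourierChar
      (continuous_inner : Continuous fun p : Rn n × Rn n => inner ℝ p.1 p.2) ψ.integrable hfi
    rw [flip_innerₗ] at this
    simp only [smul_eq_mul] at this
    exact this
  have i1 : Integrable fun ξ => ψ ξ * hat f ξ :=
    (ψ.memLp 2 volume).integrable_mul (Lp.memLp (hat f))
  have i2 : Integrable fun ξ => ψ ξ * 𝓕 (f : Rn n → ℂ) ξ := by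
    have := hcont.locallyIntegrable (μ := volume)
    have h3 := this.integrable_smul_left_of_hasCompactSupport ψ.continuous hg₁
    simpa using h3
  have : ∀ ξ, g ξ • (hat f ξ - 𝓕 (f : Rn n → ℂ) ξ) =
      ψ ξ * hat f ξ - ψ ξ * 𝓕 (f : Rn n → ℂ) ξ := by
    intro ξ
    rw [hψg, Complex.real_smul]; ring
  simp_rw [this]
  rw [integral_sub i1 i2, e1, e2, sub_self]

/-- Interpolation between the bounds `|x|` and `2`, used for `|x| ≤ 1` and `|x| ≥ 1` respectively.
-/
theorem norm_exp_I_sub_one_le_rpow {δ : ℝ} (hδ : δ ∈ Ioc (0 : ℝ) 1) (x : ℝ) :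
    ‖Complex.exp (Complex.I * x) - 1‖ ≤ 2 * |x| ^ δ := by
  rcases le_total |x| 1 with h | h
  · have h1 := Real.norm_exp_I_mul_ofReal_sub_one_le (x := x)
    have h2 : |x| ≤ |x| ^ δ := by
      rcases (abs_nonneg x).eq_or_lt with h0 | h0
      · rw [← h0, Real.zero_rpow hδ.1.ne']
      · simpa using Real.rpow_le_rpow_of_exponent_ge h0 h hδ.2
    have h3 : 0 ≤ |x| ^ δ := by positivity
    rw [Real.norm_eq_abs] at h1
    linarith
  · have h1 : ‖Complex.exp (Complex.I * x) - 1‖ ≤ 2 := by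
      refine (norm_sub_le _ _).trans ?_
      rw [Complex.norm_exp_I_mul_ofReal, norm_one]; norm_num
    have h2 : 1 ≤ |x| ^ δ := Real.one_le_rpow h hδ.1.le
    linarith

theorem integrable_weighted {δ : ℝ} {f : L2 n} (hf : weightedL1Norm δ f < ∞) :
    Integrable fun x : Rn n => (1 + ‖x‖) ^ δ * ‖f x‖ := by
  have hm : Measurable fun x : Rn n => (1 + ‖x‖) ^ δ := by fun_prop
  refine ⟨hm.aestronglyMeasurable.mul (Lp.aestronglyMeasurable f).norm, ?_⟩
  refine lt_of_eq_of_lt (lintegral_congr fun x => ?_) hf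
  rw [enorm_mul, enorm_norm, Real.enorm_of_nonneg (by positivity)]

theorem ofReal_integral_weighted {δ : ℝ} {f : L2 n} (hf : weightedL1Norm δ f < ∞) :
    ENNReal.ofReal (∫ x : Rn n, (1 + ‖x‖) ^ δ * ‖f x‖) = weightedL1Norm δ f := by
  rw [ofReal_integral_eq_lintegral_ofReal (integrable_weighted hf)
    (Eventually.of_forall fun x => by positivity), weightedL1Norm]
  refine lintegral_congr fun x => ?_
  rw [ENNReal.ofReal_mul (by positivity), ofReal_norm]

/-- The integral of `f` is `f̂(0)`, and the character differs from `1` by at most a multiple of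
`(|x| |ξ|)^δ`. -/
theorem norm_fourier_sub_integral_le {δ : ℝ} (hδ : δ ∈ Ioc (0 : ℝ) 1) {f : L2 n}
    (hf : MemLp f 1 volume) (hw : weightedL1Norm δ f < ∞) (ξ : Rn n) :
    ‖𝓕 (f : Rn n → ℂ) ξ - ∫ x, f x‖ ≤
      2 * symb δ ξ * ∫ x : Rn n, (1 + ‖x‖) ^ δ * ‖f x‖ := by
  have hfi : Integrable (f : Rn n → ℂ) := memLp_one_iff_integrable.1 hf
  rw [Real.fourier_eq, ← integral_sub ((Real.fourierIntegral_convergent_iff ξ).2 hfi) hfi,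
    ← integral_const_mul]
  refine norm_integral_le_of_norm_le ((integrable_weighted hw).const_mul _)
    (Eventually.of_forall fun x => ?_)
  have e : Real.fourierChar (-inner ℝ x ξ) • f x - f x =
      (Complex.exp (Complex.I * ((-(2 * Real.pi * inner ℝ x ξ) : ℝ) : ℂ)) - 1) * f x := by
    rw [Circle.smul_def, Real.fourierChar_apply, smul_eq_mul, sub_mul, one_mul]
    congr 3
    push_cast; ring
  rw [e, norm_mul]
  have h1 := norm_exp_I_sub_one_le_rpow hδ (-(2 * Real.pi * inner ℝ x ξ))
  have h2 : |-(2 * Real.pi * inner ℝ x ξ)| ^ δ ≤ symb δ ξ * (1 + ‖x‖) ^ δ := by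
    rw [symb, ← Real.mul_rpow (by positivity) (by positivity)]
    refine Real.rpow_le_rpow (abs_nonneg _) ?_ hδ.1.le
    have hi : |inner ℝ x ξ| ≤ ‖ξ‖ * (1 + ‖x‖) :=
      (abs_real_inner_le_norm x ξ).trans (by nlinarith [norm_nonneg x, norm_nonneg ξ])
    rw [abs_neg, abs_mul, abs_of_pos (by positivity : 0 < 2 * Real.pi)]
    linarith [mul_le_mul_of_nonneg_left hi Real.two_pi_pos.le]
  calc _ ≤ (2 * (symb δ ξ * (1 + ‖x‖) ^ δ)) * ‖f x‖ := by gcongr; linarith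
    _ = _ := by ring

/-! ### Scaling of the low-frequency profiles -/

/-- The profile `(2π|ξ|)ᵃ exp(-c t (2π|ξ|)^{2m})`. -/
noncomputable def profile (a c m t : ℝ) (ξ : Rn n) : ℝ :=
  symb a ξ * Real.exp (-(c * symb (2 * m) ξ * t))

theorem measurable_profile (a c m t : ℝ) : Measurable (profile a c m t : Rn n → ℝ) := by
  have h1 := measurable_symb (n := n) a
  have h2 := measurable_symb (n := n) (2 * m)
  unfold profile; fun_prop

theorem memLp_profile (hn : 1 ≤ n) {a c m : ℝ} (ha : 0 ≤ a) (hc : 0 < c) (hm : 0 < m) :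
    MemLp (profile a c m 1 : Rn n → ℝ) 2 volume := by
  have : Nonempty (Fin n) := ⟨⟨0, hn⟩⟩
  rw [memLp_two_iff_integrable_sq (measurable_profile a c m 1).aestronglyMeasurable]
  -- Polar coordinates reduce the claim to a Gamma-type integral on the half-line.
  have h := (integrable_fun_norm_addHaar (volume : Measure (Rn n)) (f := fun y : ℝ =>
    ((2 * Real.pi * y) ^ a * Real.exp (-(c * (2 * Real.pi * y) ^ (2 * m) * 1))) ^ 2)).2 ?_
  · exact h
  have h1 := (integrableOn_rpow_mul_exp_neg_mul_rpow (p := 2 * m) (s := n - 1 + 2 * a)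
    (b := 2 * c * (2 * Real.pi) ^ (2 * m)) (by
      have : (1 : ℝ) ≤ n := by exact_mod_cast hn
      linarith) (by positivity) (by positivity)).const_mul (((2 * Real.pi) ^ a) ^ 2)
  refine IntegrableOn.congr_fun h1 (fun y hy => ?_) measurableSet_Ioi
  have hy : 0 < y := hy
  have e0 : y ^ ((n : ℝ) - 1 + 2 * a) = y ^ (n - 1) * (y ^ a) ^ 2 := by
    rw [Real.rpow_add hy, mul_comm 2 a, Real.rpow_mul hy.le, Real.rpow_two, ← Nat.cast_one,
      ← Nat.cast_sub hn, Real.rpow_natCast]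
  have e1 : Real.exp (-(2 * c * (2 * Real.pi) ^ (2 * m)) * y ^ (2 * m)) =
      Real.exp (-(c * ((2 * Real.pi) ^ (2 * m) * y ^ (2 * m)) * 1)) ^ 2 := by
    rw [← Real.exp_nat_mul]; congr 1; push_cast; ring
  simp only [finrank_euclideanSpace, Fintype.card_fin, smul_eq_mul]
  rw [Real.mul_rpow (by positivity) hy.le, Real.mul_rpow (by positivity) hy.le, e0, e1]
  ring

/-- The dilation by `t^(1/(2m))` removes `t` from the exponential; the factor `|D|^a` yields
`t^(-a/(2m))` and the Jacobian `t^(-n/(4m))`. -/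
theorem eLpNorm_profile {a c m t : ℝ} (hm : 0 < m) (ht : 0 < t) :
    eLpNorm (profile a c m t : Rn n → ℝ) 2 volume =
      ENNReal.ofReal (t ^ (-((n + 2 * a) / (4 * m)))) *
        eLpNorm (profile a c m 1 : Rn n → ℝ) 2 volume := by
  set l : ℝ := t ^ (1 / (2 * m)) with hl
  have hl0 : 0 < l := Real.rpow_pos_of_pos ht _
  have hs : ∀ (b : ℝ) (ξ : Rn n), symb b (l • ξ) = l ^ b * symb b ξ := by
    intro b ξ
    rw [symb, symb, norm_smul, Real.norm_of_nonneg hl0.le, ← Real.mul_rpow hl0.le (by positivity)]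
    congr 1; ring
  have hlm : l ^ (2 * m) = t := by
    rw [hl, ← Real.rpow_mul ht.le]
    have : 1 / (2 * m) * (2 * m) = 1 := by field_simp
    rw [this, Real.rpow_one]
  have e1 : (profile a c m t : Rn n → ℝ) = l ^ (-a) • ((profile a c m 1) ∘ fun ξ => l • ξ) := by
    ext ξ
    simp only [Pi.smul_apply, Function.comp, profile, smul_eq_mul, hs, hlm]
    rw [← mul_assoc, ← mul_assoc, ← Real.rpow_add hl0]
    simp only [neg_add_cancel, Real.rpow_zero, one_mul]
    congr 3; ring
  have e2 : eLpNorm ((profile a c m 1 : Rn n → ℝ) ∘ fun ξ => l • ξ) 2 volume =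
      ENNReal.ofReal (l ^ (-(n / 2 : ℝ))) * eLpNorm (profile a c m 1 : Rn n → ℝ) 2 volume := by
    rw [← eLpNorm_map_measure (measurable_profile a c m 1).aestronglyMeasurable (by fun_prop),
      Measure.map_addHaar_smul volume hl0.ne',
      eLpNorm_smul_measure_of_ne_top (by norm_num), smul_eq_mul]
    congr 1
    rw [finrank_euclideanSpace, Fintype.card_fin, abs_of_pos (by positivity),
      ENNReal.ofReal_rpow_of_pos (by positivity), ← Real.rpow_natCast, ← Real.rpow_neg hl0.le,
      ← Real.rpow_mul hl0.le]
    congr 2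
    simp; ring
  rw [e1, eLpNorm_const_smul, e2, ← mul_assoc, Real.enorm_of_nonneg (by positivity),
    ← ENNReal.ofReal_mul (by positivity), ← Real.rpow_add hl0, hl, ← Real.rpow_mul ht.le]
  congr 3
  field_simp
  ring

/-- This is `y ≤ exp y` at `y = c x / γ`, raised to the power `γ`. -/
theorem rpow_le_mul_exp {γ c x : ℝ} (hγ : 0 < γ) (hc : 0 < c) (hx : 0 ≤ x) :
    x ^ γ ≤ (γ / c) ^ γ * Real.exp (c * x) := by
  have h1 : (c * x / γ) ^ γ ≤ Real.exp (c * x) := by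
    calc (c * x / γ) ^ γ ≤ (Real.exp (c * x / γ)) ^ γ := by
          refine Real.rpow_le_rpow (by positivity) ?_ hγ.le
          linarith [Real.add_one_le_exp (c * x / γ)]
      _ = _ := by rw [← Real.exp_mul]; congr 1; field_simp
  calc x ^ γ = (γ / c) ^ γ * (c * x / γ) ^ γ := by
        rw [← Real.mul_rpow (by positivity) (by positivity)]; congr 1; field_simp
    _ ≤ _ := by gcongr

theorem exp_neg_le_mul_rpow {γ c t : ℝ} (hγ : 0 < γ) (hc : 0 < c) (ht : 0 ≤ t) :
    Real.exp (-(c * t)) ≤ (γ / c) ^ γ * Real.exp c * (1 + t) ^ (-γ) := by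
  have h := rpow_le_mul_exp hγ hc (by linarith : 0 ≤ 1 + t)
  rw [Real.rpow_neg (by linarith), ← div_eq_mul_inv, le_div_iff₀ (by positivity)]
  calc Real.exp (-(c * t)) * (1 + t) ^ γ
      ≤ Real.exp (-(c * t)) * ((γ / c) ^ γ * Real.exp (c * (1 + t))) := by gcongr
    _ = (γ / c) ^ γ * (Real.exp (-(c * t)) * Real.exp (c * (1 + t))) := by ring
    _ = _ := by rw [← Real.exp_add]; congr 2; ring

/-- For `r ≥ 1` both `r^(2σ)` and `r²` are at most `r⁴`, precisely because `σ ≤ 2`; hence no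
regularity is lost at high frequency. -/
theorem one_le_rate_of_one_le {σ r : ℝ} (hσ : σ ∈ Icc (0 : ℝ) 2) (hr : 1 ≤ r) :
    1 ≤ rate (r ^ (2 : ℝ)) (r ^ (2 * σ)) := by
  have hr0 : 0 < r := by linarith
  have e : (r ^ (2 : ℝ)) ^ 2 = r ^ (4 : ℝ) := by
    rw [← Real.rpow_natCast, ← Real.rpow_mul hr0.le]; norm_num
  rw [rate, one_le_div (by positivity), e]
  exact max_le (Real.rpow_le_rpow_of_exponent_le hr (by linarith [hσ.2]))
    (Real.rpow_le_rpow_of_exponent_le hr (by norm_num))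

/-- For `r ≤ 1` the larger of `r^(2σ)` and `r²` has the smaller exponent, and `4 - min (2σ) 2 = 2
max (2-σ) 1`. -/
theorem rpow_le_rate_of_le_one {σ r : ℝ} (hr0 : 0 < r) (hr : r ≤ 1) :
    r ^ (2 * max (2 - σ) 1) ≤ rate (r ^ (2 : ℝ)) (r ^ (2 * σ)) := by
  have e : (r ^ (2 : ℝ)) ^ 2 = r ^ (4 : ℝ) := by
    rw [← Real.rpow_natCast, ← Real.rpow_mul hr0.le]; norm_num
  have h1 := le_max_left (2 - σ) 1
  have h2 := le_max_right (2 - σ) 1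
  rw [rate, le_div_iff₀ (by positivity), e, mul_max_of_nonneg _ _ (by positivity),
    ← Real.rpow_add hr0, ← Real.rpow_add hr0]
  exact max_le (Real.rpow_le_rpow_of_exponent_ge hr0 hr (by linarith))
    (Real.rpow_le_rpow_of_exponent_ge hr0 hr (by linarith))

theorem decayExponent_one (σ : ℝ) (n : ℕ) (s : ℝ) :
    decayExponent σ n 1 s = (n + 2 * s) / (4 * max (2 - σ) 1) := by
  unfold decayExponent
  split_ifs with h
  · rw [max_eq_left (by linarith)]; congr 1 <;> ring
  · rw [max_eq_right (by linarith)]; congr 1; ring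

/-! ### Decay of the contribution of one datum -/

/-- The evolved frequency profile of one datum. -/
noncomputable def evolved (σ s c t : ℝ) (f : L2 n) (ξ : Rn n) : ℝ :=
  symb s ξ * Real.exp (-(c * rate (symb 2 ξ) (symb (2 * σ) ξ) * t)) * ‖hat f ξ‖

theorem evolved_nonneg (σ s c t : ℝ) (f : L2 n) (ξ : Rn n) : 0 ≤ evolved σ s c t f ξ :=
  mul_nonneg (mul_nonneg (symb_nonneg s ξ) (Real.exp_pos _).le) (norm_nonneg _)

theorem aestronglyMeasurable_evolved (σ s c t : ℝ) (f : L2 n) :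
    AEStronglyMeasurable (evolved σ s c t f) volume := by
  have h1 := measurable_symb (n := n) s
  have h2 := measurable_rate (n := n) σ
  have h3 : Measurable fun ξ : Rn n =>
      symb s ξ * Real.exp (-(c * rate (symb 2 ξ) (symb (2 * σ) ξ) * t)) := by fun_prop
  exact h3.aestronglyMeasurable.mul (Lp.aestronglyMeasurable _).norm

/-- The modulus of the symbol side of `⟨D⟩ˢ f`. -/
noncomputable def besselProfile (s : ℝ) (f : L2 n) (ξ : Rn n) : ℝ :=
  (1 + (2 * Real.pi * ‖ξ‖) ^ 2) ^ (s / 2) * ‖hat f ξ‖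

theorem eLpNorm_besselProfile (s : ℝ) (f : L2 n) :
    eLpNorm (besselProfile s f) 2 volume = sobolevNorm s f := by
  refine eLpNorm_congr_norm_ae (Eventually.of_forall fun ξ => ?_)
  rw [besselProfile, norm_mul, norm_mul, Complex.norm_real, norm_norm]

theorem aestronglyMeasurable_besselProfile (s : ℝ) (f : L2 n) :
    AEStronglyMeasurable (besselProfile s f) volume := by
  have h : Measurable fun ξ : Rn n => (1 + (2 * Real.pi * ‖ξ‖) ^ 2) ^ (s / 2) := by fun_prop
  exact h.aestronglyMeasurable.mul (Lp.aestronglyMeasurable _).norm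

theorem evolved_le_high {σ s c t : ℝ} (hσ : σ ∈ Icc (0 : ℝ) 2) (hs : 0 ≤ s) (hc : 0 < c)
    (ht : 0 ≤ t) (f : L2 n) {ξ : Rn n} (hξ : 1 ≤ 2 * Real.pi * ‖ξ‖) :
    evolved σ s c t f ξ ≤ Real.exp (-(c * t)) * besselProfile s f ξ := by
  have h1 : symb s ξ ≤ (1 + (2 * Real.pi * ‖ξ‖) ^ 2) ^ (s / 2) := by
    have e : symb s ξ = ((2 * Real.pi * ‖ξ‖) ^ 2) ^ (s / 2) := by
      rw [← Real.rpow_natCast, ← Real.rpow_mul (by positivity), symb]; congr 1; push_cast; ring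
    rw [e]
    exact Real.rpow_le_rpow (by positivity) (by linarith) (by positivity)
  have h2 : 1 ≤ rate (symb 2 ξ) (symb (2 * σ) ξ) := one_le_rate_of_one_le hσ hξ
  have h3 : c * t ≤ c * rate (symb 2 ξ) (symb (2 * σ) ξ) * t := by
    nlinarith [mul_nonneg hc.le ht]
  calc evolved σ s c t f ξ
      ≤ (1 + (2 * Real.pi * ‖ξ‖) ^ 2) ^ (s / 2) * Real.exp (-(c * t)) * ‖hat f ξ‖ := by
        unfold evolved
        gcongr
    _ = _ := by unfold besselProfile; ring

/-- Replacing `t` by `1 + t` costs only `exp c`, the symbol being at most `1` here; this avoids the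
singularity of the scaling law at `t = 0`. -/
theorem symb_mul_exp_le_profile {σ a c t : ℝ} (hc : 0 < c) (ht : 0 ≤ t) {ξ : Rn n} (h0 : ξ ≠ 0)
    (hξ : 2 * Real.pi * ‖ξ‖ ≤ 1) :
    symb a ξ * Real.exp (-(c * rate (symb 2 ξ) (symb (2 * σ) ξ) * t)) ≤
      Real.exp c * profile a c (max (2 - σ) 1) (1 + t) ξ := by
  have hr0 : 0 < 2 * Real.pi * ‖ξ‖ := by positivity
  have h2 : symb (2 * max (2 - σ) 1) ξ ≤ rate (symb 2 ξ) (symb (2 * σ) ξ) :=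
    rpow_le_rate_of_le_one hr0 hξ
  have h3 : symb (2 * max (2 - σ) 1) ξ ≤ 1 :=
    Real.rpow_le_one hr0.le hξ (by linarith [le_max_right (2 - σ) 1])
  have h4 : Real.exp (-(c * rate (symb 2 ξ) (symb (2 * σ) ξ) * t)) ≤
      Real.exp c * Real.exp (-(c * symb (2 * max (2 - σ) 1) ξ * (1 + t))) := by
    rw [← Real.exp_add]
    refine Real.exp_le_exp.2 ?_
    have h5 := mul_le_mul_of_nonneg_left h2 (mul_nonneg hc.le ht)
    have h6 := mul_le_mul_of_nonneg_left h3 hc.le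
    linarith
  calc _ ≤ symb a ξ * (Real.exp c * Real.exp (-(c * symb (2 * max (2 - σ) 1) ξ * (1 + t)))) := by
        have := symb_nonneg a ξ
        gcongr
    _ = _ := by unfold profile; ring

theorem evolved_le_low {σ s δ c t : ℝ} (hδ : δ ∈ Ioc (0 : ℝ) 1) (hc : 0 < c) (ht : 0 ≤ t)
    {f : L2 n} (hf : MemLp f 1 volume) (hw : weightedL1Norm δ f < ∞) {ξ : Rn n} (h0 : ξ ≠ 0)
    (hξ : 2 * Real.pi * ‖ξ‖ ≤ 1) (hhat : hat f ξ = 𝓕 (f : Rn n → ℂ) ξ) :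
    evolved σ s c t f ξ ≤
      (2 * Real.exp c * ∫ x : Rn n, (1 + ‖x‖) ^ δ * ‖f x‖) *
          profile (s + δ) c (max (2 - σ) 1) (1 + t) ξ +
        (Real.exp c * ‖∫ x, f x‖) * profile s c (max (2 - σ) 1) (1 + t) ξ := by
  have hr0 : 0 < 2 * Real.pi * ‖ξ‖ := by positivity
  set M := ∫ x : Rn n, (1 + ‖x‖) ^ δ * ‖f x‖
  have hM : 0 ≤ M := integral_nonneg fun x => by positivity
  have h1 : ‖hat f ξ‖ ≤ 2 * symb δ ξ * M + ‖∫ x, f x‖ := by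
    have := norm_fourier_sub_integral_le hδ hf hw ξ
    rw [hhat]
    linarith [norm_sub_norm_le (𝓕 (f : Rn n → ℂ) ξ) (∫ x, f x)]
  have e : symb (s + δ) ξ = symb s ξ * symb δ ξ := Real.rpow_add hr0 _ _
  have h2 := symb_mul_exp_le_profile (σ := σ) (a := s + δ) hc ht h0 hξ
  have h3 := symb_mul_exp_le_profile (σ := σ) (a := s) hc ht h0 hξ
  set X := Real.exp (-(c * rate (symb 2 ξ) (symb (2 * σ) ξ) * t)) with hX
  calc evolved σ s c t f ξ
      ≤ symb s ξ * X * (2 * symb δ ξ * M + ‖∫ x, f x‖) := by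
        have := symb_nonneg s ξ
        unfold evolved
        gcongr
    _ = 2 * M * (symb (s + δ) ξ * X) + ‖∫ x, f x‖ * (symb s ξ * X) := by rw [e]; ring
    _ ≤ 2 * M * (Real.exp c * profile (s + δ) c (max (2 - σ) 1) (1 + t) ξ) +
        ‖∫ x, f x‖ * (Real.exp c * profile s c (max (2 - σ) 1) (1 + t) ξ) := by gcongr
    _ = _ := by ring

theorem eLpNorm_add_three_le {f g h : Rn n → ℝ} (hf : AEStronglyMeasurable f volume)
    (hg : AEStronglyMeasurable g volume) (hh : AEStronglyMeasurable h volume) :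
    eLpNorm (fun x => f x + g x + h x) 2 volume ≤
      eLpNorm f 2 volume + eLpNorm g 2 volume + eLpNorm h 2 volume :=
  (eLpNorm_add_le (hf.add hg) hh one_le_two).trans
    (add_le_add_left (eLpNorm_add_le hf hg one_le_two) _)

theorem eLpNorm_const_mul_of_nonneg {c : ℝ} (hc : 0 ≤ c) (f : Rn n → ℝ) :
    eLpNorm (fun x => c * f x) 2 volume = ENNReal.ofReal c * eLpNorm f 2 volume := by
  have := eLpNorm_const_smul c f 2 (volume : Measure (Rn n))
  rwa [Real.enorm_of_nonneg hc] at this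

/-- Decay of the evolved profile of one datum in `Hˢ ∩ L^{1,δ}`. -/
theorem exists_eLpNorm_evolved_le (hn : 1 ≤ n) {σ s δ c : ℝ} (hσ : σ ∈ Icc (0 : ℝ) 2)
    (hs : 0 ≤ s) (hδ : δ ∈ Ioc (0 : ℝ) 1) (hc : 0 < c) :
    ∃ K : ℝ≥0, ∀ f : L2 n, MemSobolevWeightedL1 s δ f → ∀ t : ℝ, 0 ≤ t →
      eLpNorm (evolved σ s c t f) 2 volume ≤
        K * (ENNReal.ofReal ((1 + t) ^ (-decayExponent σ n 1 (s + δ))) *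
              (sobolevNorm s f + weightedL1Norm δ f) +
            ENNReal.ofReal ((1 + t) ^ (-decayExponent σ n 1 s)) * ‖∫ x, f x‖ₑ) := by
  set m := max (2 - σ) 1 with hm
  have hm1 : 1 ≤ m := le_max_right _ _
  have hm0 : 0 < m := by linarith
  set γ := decayExponent σ n 1 (s + δ) with hγ
  have hγ0 : 0 < γ := by
    have : (1 : ℝ) ≤ n := by exact_mod_cast hn
    have := hδ.1
    rw [hγ, decayExponent_one]; positivity
  set N₁ := (eLpNorm (profile (s + δ) c m 1 : Rn n → ℝ) 2 volume).toNNReal with hN₁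
  set N₂ := (eLpNorm (profile s c m 1 : Rn n → ℝ) 2 volume).toNNReal with hN₂
  have eN₁ : eLpNorm (profile (s + δ) c m 1 : Rn n → ℝ) 2 volume = N₁ :=
    (ENNReal.coe_toNNReal (memLp_profile hn (by linarith [hδ.1]) hc hm0).eLpNorm_ne_top).symm
  have eN₂ : eLpNorm (profile s c m 1 : Rn n → ℝ) 2 volume = N₂ :=
    (ENNReal.coe_toNNReal (memLp_profile hn hs hc hm0).eLpNorm_ne_top).symm
  set K₀ : ℝ := (γ / c) ^ γ * Real.exp c with hK₀
  have hK₀0 : 0 ≤ K₀ := by positivity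
  refine ⟨K₀.toNNReal + (2 * Real.exp c).toNNReal * N₁ + (Real.exp c).toNNReal * N₂,
    fun f hf t ht => ?_⟩
  obtain ⟨-, hf1, hfw⟩ := hf
  set M := ∫ x : Rn n, (1 + ‖x‖) ^ δ * ‖f x‖ with hM
  have hM0 : 0 ≤ M := integral_nonneg fun x => by positivity
  have ht1 : 0 < 1 + t := by linarith
  have hprof : ∀ a (ξ : Rn n), 0 ≤ profile a c m (1 + t) ξ := fun a ξ =>
    mul_nonneg (symb_nonneg a ξ) (Real.exp_pos _).le
  have hbes : ∀ ξ : Rn n, 0 ≤ besselProfile s f ξ := fun ξ => by unfold besselProfile; positivity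
  -- The first term bounds high frequencies, whose exponential decay is weakened to the faster
  -- polynomial rate `γ`; the other two bound low frequencies.
  have hpt : ∀ᵐ ξ : Rn n, ‖evolved σ s c t f ξ‖ ≤
      K₀ * (1 + t) ^ (-γ) * besselProfile s f ξ +
        2 * Real.exp c * M * profile (s + δ) c m (1 + t) ξ +
        Real.exp c * ‖∫ x, f x‖ * profile s c m (1 + t) ξ := by
    filter_upwards [ae_ne_zero hn, hat_ae_eq_fourier hf1] with ξ h0 hhat
    have h1 := mul_nonneg (mul_nonneg (by positivity : 0 ≤ 2 * Real.exp c) hM0) (hprof (s + δ) ξ)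
    have h2 := mul_nonneg (mul_nonneg (Real.exp_pos c).le (norm_nonneg (∫ x, f x))) (hprof s ξ)
    have h3 := mul_nonneg (mul_nonneg hK₀0 (Real.rpow_nonneg ht1.le (-γ))) (hbes ξ)
    rw [Real.norm_of_nonneg (evolved_nonneg σ s c t f ξ)]
    rcases le_total 1 (2 * Real.pi * ‖ξ‖) with h | h
    · have h4 := evolved_le_high hσ hs hc ht f h
      have h5 := mul_le_mul_of_nonneg_right (exp_neg_le_mul_rpow hγ0 hc ht) (hbes ξ)
      linarith
    · have h4 := evolved_le_low (σ := σ) (s := s) hδ hc ht hf1 hfw h0 h hhat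
      linarith
  refine (eLpNorm_mono_ae_real hpt).trans ((eLpNorm_add_three_le
    ((aestronglyMeasurable_besselProfile s f).const_mul _)
    ((measurable_profile (s + δ) c m (1 + t)).aestronglyMeasurable.const_mul _)
    ((measurable_profile s c m (1 + t)).aestronglyMeasurable.const_mul _)).trans ?_)
  rw [eLpNorm_const_mul_of_nonneg (by positivity), eLpNorm_const_mul_of_nonneg (by positivity),
    eLpNorm_const_mul_of_nonneg (by positivity), eLpNorm_besselProfile, eLpNorm_profile hm0 ht1,
    eLpNorm_profile hm0 ht1, eN₁, eN₂, hm, ← decayExponent_one, ← decayExponent_one, ← hγ,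
    ENNReal.ofReal_mul hK₀0, ENNReal.ofReal_mul (p := 2 * Real.exp c) (by positivity), ofReal_integral_weighted hfw,
    ENNReal.ofReal_mul (Real.exp_pos c).le, ofReal_norm]
  set D₁ := ENNReal.ofReal ((1 + t) ^ (-γ))
  set D₂ := ENNReal.ofReal ((1 + t) ^ (-decayExponent σ n 1 s))
  set k₀ := ENNReal.ofReal K₀
  set k₁ := ENNReal.ofReal (2 * Real.exp c)
  set k₂ := ENNReal.ofReal (Real.exp c)
  have hK : ((K₀.toNNReal + (2 * Real.exp c).toNNReal * N₁ + (Real.exp c).toNNReal * N₂ : ℝ≥0) :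
      ℝ≥0∞) = k₀ + k₁ * N₁ + k₂ * N₂ := by
    push_cast; rfl
  rw [hK]
  have b₀ : k₀ ≤ k₀ + k₁ * N₁ + k₂ * N₂ := le_add_right le_self_add
  have b₁ : k₁ * N₁ ≤ k₀ + k₁ * N₁ + k₂ * N₂ := le_add_right le_add_self
  have b₂ : k₂ * N₂ ≤ k₀ + k₁ * N₁ + k₂ * N₂ := le_add_self
  set K := k₀ + k₁ * N₁ + k₂ * N₂
  calc _ = k₀ * (D₁ * sobolevNorm s f) + (k₁ * N₁) * (D₁ * weightedL1Norm δ f) +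
        (k₂ * N₂) * (D₂ * ‖∫ x, f x‖ₑ) := by ring
    _ ≤ K * (D₁ * sobolevNorm s f) + K * (D₁ * weightedL1Norm δ f) +
        K * (D₂ * ‖∫ x, f x‖ₑ) := by gcongr
    _ = _ := by ring

/-! ### Assembling the decay estimate -/

theorem IsSolution.w_zero (h : IsSolution σ u₀ u₁ θ₀ u w v θ) {w₀ : L2 n}
    (hw₀ : -(Δ u₀) = toDist w₀) : w 0 = w₀ := by
  rw [← sub_eq_zero]
  refine eq_zero_of_toDist_eq_zero fun φ => ?_
  have h0 := h.neg_laplacian_eq 0 le_rfl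
  rw [h.u_zero, hw₀] at h0
  rw [← testCLM_apply, map_sub, testCLM_apply, testCLM_apply, h0, sub_self]

/-- The constant `1 / 192` is half of `1 / 96`: the energy is quadratic, so amplitudes decay at half
its rate. -/
theorem homSobolevNorm_le (hn : 1 ≤ n) (h : IsSolution σ u₀ u₁ θ₀ u w v θ)
    (hσ : σ ∈ Icc (0 : ℝ) 2) (s : ℝ) {t : ℝ} (ht : 0 ≤ t) {z : L2 n}
    (hz : z = w t ∨ z = v t ∨ z = θ t) :
    homSobolevNorm s z ≤ 2 * (eLpNorm (evolved σ s (1 / 192) t (w 0)) 2 volume +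
      eLpNorm (evolved σ s (1 / 192) t (v 0)) 2 volume +
      eLpNorm (evolved σ s (1 / 192) t (θ 0)) 2 volume) := by
  have hσ4 : 2 * σ ∈ Icc (0 : ℝ) 4 := ⟨by linarith [hσ.1], by linarith [hσ.2]⟩
  have hpt : ∀ᵐ ξ : Rn n, ‖(((2 * Real.pi * ‖ξ‖) ^ s : ℝ) : ℂ) * hat z ξ‖ ≤
      2 * (evolved σ s (1 / 192) t (w 0) ξ + evolved σ s (1 / 192) t (v 0) ξ +
        evolved σ s (1 / 192) t (θ 0) ξ) := by
    filter_upwards [ae_energy_hat_le hn h hσ4 ht] with ξ hξ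
    have e : rate (symb 2 ξ) (symb (2 * σ) ξ) / 96 * t =
        2 * (1 / 192 * rate (symb 2 ξ) (symb (2 * σ) ξ) * t) := by ring
    rw [e] at hξ
    have h1 := norm_le_of_energy_le hξ (hat z ξ) (by rcases hz with h | h | h <;> simp [h])
    have h2 := mul_le_mul_of_nonneg_left h1 (symb_nonneg s ξ)
    rw [norm_mul, Complex.norm_real, Real.norm_of_nonneg (by positivity)]
    refine h2.trans_eq ?_
    unfold evolved
    ring
  refine (eLpNorm_mono_ae_real hpt).trans ?_
  rw [eLpNorm_const_mul_of_nonneg (by norm_num), ENNReal.ofReal_ofNat]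
  gcongr
  exact eLpNorm_add_three_le (aestronglyMeasurable_evolved ..) (aestronglyMeasurable_evolved ..)
    (aestronglyMeasurable_evolved ..)

/-- The integrals of `u₁` and `w₀` are the half-sum and half-difference of the first two components
of `∫ U₀`, so each of the three integrals is bounded by its norm. -/
theorem enorm_integral_add_le {w₀ u₁ θ₀ : L2 n} (hw : MemLp w₀ 1 volume)
    (hu : MemLp u₁ 1 volume) (hθ : MemLp θ₀ 1 volume) :
    ‖∫ x, w₀ x‖ₑ + ‖∫ x, u₁ x‖ₑ + ‖∫ x, θ₀ x‖ₑ ≤ 3 * ‖∫ x, initialU w₀ u₁ θ₀ x‖ₑ := by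
  rw [memLp_one_iff_integrable] at hw hu hθ
  have hU : Integrable (initialU w₀ u₁ θ₀) := by
    refine Integrable.of_eval_piLp fun i => ?_
    fin_cases i
    · exact hu.add hw
    · exact hu.sub hw
    · exact hθ
  set I := ∫ x, initialU w₀ u₁ θ₀ x with hI
  have hproj : ∀ i : Fin 3, I i = ∫ x, initialU w₀ u₁ θ₀ x i := fun i =>
    ((EuclideanSpace.proj i : EuclideanSpace ℂ (Fin 3) →L[ℂ] ℂ).integral_comp_comm hU).symm
  have h0 : I 0 = (∫ x, u₁ x) + ∫ x, w₀ x := (hproj 0).trans (integral_add hu hw)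
  have h1 : I 1 = (∫ x, u₁ x) - ∫ x, w₀ x := (hproj 1).trans (integral_sub hu hw)
  have h2 : I 2 = ∫ x, θ₀ x := hproj 2
  have n0 := PiLp.norm_apply_le I 0
  have n1 := PiLp.norm_apply_le I 1
  have n2 := PiLp.norm_apply_le I 2
  have hw' : ‖∫ x, w₀ x‖ ≤ ‖I‖ := by
    have e : (2 : ℂ) * ∫ x, w₀ x = I 0 - I 1 := by rw [h0, h1]; ring
    have := norm_sub_le (I 0) (I 1)
    rw [← e, norm_mul, Complex.norm_ofNat] at this
    linarith
  have hu' : ‖∫ x, u₁ x‖ ≤ ‖I‖ := by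
    have e : (2 : ℂ) * ∫ x, u₁ x = I 0 + I 1 := by rw [h0, h1]; ring
    have := norm_add_le (I 0) (I 1)
    rw [← e, norm_mul, Complex.norm_ofNat] at this
    linarith
  rw [h2] at n2
  calc _ ≤ ‖I‖ₑ + ‖I‖ₑ + ‖I‖ₑ := by
        gcongr <;> rw [enorm_le_iff_norm_le] <;> assumption
    _ = _ := by ring

theorem exists_decay_estimate (hn : 1 ≤ n) {s δ : ℝ} (hσ : σ ∈ Icc (0 : ℝ) 2) (hs : 0 ≤ s)
    (hδ : δ ∈ Ioc (0 : ℝ) 1) :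
    ∃ C : ℝ≥0, 0 < C ∧ ∀ (u₀ : 𝓢'(Rn n, ℂ)) (w₀ u₁ θ₀ : L2 n), -(Δ u₀) = toDist w₀ →
      MemSobolevWeightedL1 s δ w₀ → MemSobolevWeightedL1 s δ u₁ → MemSobolevWeightedL1 s δ θ₀ →
      ∀ (u : ℝ → 𝓢'(Rn n, ℂ)) (w v θ : ℝ → L2 n), IsSolution σ u₀ u₁ θ₀ u w v θ →
      ∀ t : ℝ, 0 ≤ t →
        homSobolevNorm s (w t) + homSobolevNorm s (v t) + homSobolevNorm s (θ t) ≤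
          C * (ENNReal.ofReal ((1 + t) ^ (-decayExponent σ n 1 (s + δ))) * dataNorm s δ w₀ u₁ θ₀ +
            ENNReal.ofReal ((1 + t) ^ (-decayExponent σ n 1 s)) *
              ‖∫ x, initialU w₀ u₁ θ₀ x‖ₑ) := by
  obtain ⟨K, hK⟩ := exists_eLpNorm_evolved_le hn hσ hs hδ (c := 1 / 192) (by norm_num)
  -- Three norms, each with a factor `2`, and the `3` from the integrals of the data give `18`;
  -- adding `1` ensures positivity.
  refine ⟨18 * K + 1, by positivity, fun u₀ w₀ u₁ θ₀ hw₀ mw mu mθ u w v θ h t ht => ?_⟩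
  have b1 := homSobolevNorm_le hn h hσ s ht (z := w t) (by simp)
  have b2 := homSobolevNorm_le hn h hσ s ht (z := v t) (by simp)
  have b3 := homSobolevNorm_le hn h hσ s ht (z := θ t) (by simp)
  rw [h.w_zero hw₀, h.v_zero, h.θ_zero] at b1 b2 b3
  have k1 := hK w₀ mw t ht
  have k2 := hK u₁ mu t ht
  have k3 := hK θ₀ mθ t ht
  have hI := enorm_integral_add_le mw.2.1 mu.2.1 mθ.2.1
  set D₁ := ENNReal.ofReal ((1 + t) ^ (-decayExponent σ n 1 (s + δ)))
  set D₂ := ENNReal.ofReal ((1 + t) ^ (-decayExponent σ n 1 s))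
  set I := ‖∫ x, initialU w₀ u₁ θ₀ x‖ₑ
  set N := dataNorm s δ w₀ u₁ θ₀ with hN
  set E₁ := eLpNorm (evolved σ s (1 / 192) t w₀) 2 volume
  set E₂ := eLpNorm (evolved σ s (1 / 192) t u₁) 2 volume
  set E₃ := eLpNorm (evolved σ s (1 / 192) t θ₀) 2 volume
  have h3 : D₁ * N ≤ 3 * (D₁ * N) := le_mul_of_one_le_left zero_le (by norm_num)
  calc _ ≤ 2 * (E₁ + E₂ + E₃) + 2 * (E₁ + E₂ + E₃) + 2 * (E₁ + E₂ + E₃) := by gcongr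
    _ = 6 * (E₁ + E₂ + E₃) := by ring
    _ ≤ 6 * (K * (D₁ * (sobolevNorm s w₀ + weightedL1Norm δ w₀) + D₂ * ‖∫ x, w₀ x‖ₑ) +
          K * (D₁ * (sobolevNorm s u₁ + weightedL1Norm δ u₁) + D₂ * ‖∫ x, u₁ x‖ₑ) +
          K * (D₁ * (sobolevNorm s θ₀ + weightedL1Norm δ θ₀) + D₂ * ‖∫ x, θ₀ x‖ₑ)) := by gcongr
    _ = 6 * K * (D₁ * N + D₂ * (‖∫ x, w₀ x‖ₑ + ‖∫ x, u₁ x‖ₑ + ‖∫ x, θ₀ x‖ₑ)) := by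
        rw [hN, dataNorm]; ring
    _ ≤ 6 * K * (3 * (D₁ * N) + D₂ * (3 * I)) := by
        gcongr
    _ = 18 * K * (D₁ * N + D₂ * I) := by ring
    _ ≤ _ := by
        push_cast
        gcongr
        exact le_self_add

theorem decayExponent_add (σ : ℝ) (n : ℕ) (s δ : ℝ) :
    decayExponent σ n 1 (s + δ) = decayExponent σ n 1 s + δ / (2 * max (2 - σ) 1) := by
  have : 0 < max (2 - σ) 1 := lt_of_lt_of_le one_pos (le_max_right _ _)
  rw [decayExponent_one, decayExponent_one]
  field_simp
  ring

end ThermoPlate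

theorem mainTheorem7 (n : ℕ) (hn : 1 ≤ n) (σ s δ : ℝ) (hσ : σ ∈ Set.Icc (0 : ℝ) 2) (hs : 0 ≤ s)
    (hδ : δ ∈ Set.Ioc (0 : ℝ) 1) :
    ∃ C : ℝ≥0, 0 < C ∧
      ∀ (u₀ : 𝓢'(ThermoPlate.Rn n, ℂ)) (w₀ u₁ θ₀ : ThermoPlate.L2 n),
        -(Δ u₀) = ThermoPlate.toDist w₀ →
        ThermoPlate.MemSobolevWeightedL1 s δ w₀ →
        ThermoPlate.MemSobolevWeightedL1 s δ u₁ →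
        ThermoPlate.MemSobolevWeightedL1 s δ θ₀ →
        ∀ (u : ℝ → 𝓢'(ThermoPlate.Rn n, ℂ)) (w v θ : ℝ → ThermoPlate.L2 n),
          ThermoPlate.IsSolution σ u₀ u₁ θ₀ u w v θ →
          (∀ t : ℝ, 0 ≤ t →
            ThermoPlate.homSobolevNorm s (w t) + ThermoPlate.homSobolevNorm s (v t) +
                ThermoPlate.homSobolevNorm s (θ t) ≤
              C * (ENNReal.ofReal ((1 + t) ^ (-ThermoPlate.decayExponent σ n 1 (s + δ))) *
                    ThermoPlate.dataNorm s δ w₀ u₁ θ₀ +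
                  ENNReal.ofReal ((1 + t) ^ (-ThermoPlate.decayExponent σ n 1 s)) *
                    ‖∫ x : ThermoPlate.Rn n, ThermoPlate.initialU w₀ u₁ θ₀ x‖ₑ)) ∧
          ((∫ x : ThermoPlate.Rn n, ThermoPlate.initialU w₀ u₁ θ₀ x) = 0 →
            ∀ t : ℝ, 0 ≤ t →
              ThermoPlate.homSobolevNorm s (w t) + ThermoPlate.homSobolevNorm s (v t) +
                  ThermoPlate.homSobolevNorm s (θ t) ≤
                C * (ENNReal.ofReal ((1 + t) ^ (-ThermoPlate.decayExponent σ n 1 s) *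
                      (1 + t) ^ (-(δ / (2 * max (2 - σ) 1)))) *
                    ThermoPlate.dataNorm s δ w₀ u₁ θ₀)) := by
  obtain ⟨C, hC, hdecay⟩ := ThermoPlate.exists_decay_estimate hn hσ hs hδ
  refine ⟨C, hC, fun u₀ w₀ u₁ θ₀ hw₀ mw mu mθ u w v θ h => ?_⟩
  have hmain := hdecay u₀ w₀ u₁ θ₀ hw₀ mw mu mθ u w v θ h
  refine ⟨hmain, fun hzero t ht => ?_⟩
  have h1 := hmain t ht
  rw [hzero, enorm_zero, mul_zero, add_zero, ThermoPlate.decayExponent_add, neg_add,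
    Real.rpow_add (by linarith)] at h1
  exact h1
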